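/- Let $\Phi_1,\dots,\Phi_J:\mathbb{R}^d\to\mathbb{R}^d$ be similitudes with scaling ratios $0<r_j<1$, let $F=\bigcup_{j}\Phi_j(F)$ be the associated self-similar fractal (nonempty and compact), and let $C$ be its convex hull, with $\dim C=d$. Write $\Phi(A)=\bigcup_j\Phi_j(A)$. Assume the tileset condition (the sets $\Phi_j(\operatorname{int}C)$ are pairwise disjoint and contained in $\operatorname{int}C$) and the non-triviality condition $\operatorname{int}C\not\subseteq\Phi(C)$. Let $D$ be the real root of $\sum_j r_j^D=1$ and assume $d-1<D<d$. For a set $A$ let $V_A(\varepsilon)$ be the volume of $\{x\in A:\operatorname{dist}(x,A^c)\le\varepsilon\}$. Put $T_1=\operatorname{int}(C\setminus\Phi(C))$, $T_n=\Phi^{n-1}(T_1)$ and $V_{\mathcal T}(\varepsilon)=\sum_{n\ge1}V_{T_n}(\varepsilon)$. Assume that $T_1=:G$ is connected (a single generator), let $g$ be its inradius (the supremum of the radii of balls contained in $G$), and suppose that for some $0<h<g$ and real numbers $\kappa_0,\dots,\kappa_{d-1}$ \[ V_G(\varepsilon)=\sum_{i=0}^{d-1}\kappa_i\varepsilon^{d-i}\quad(0<\varepsilon<h),\qquad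 V_G(\varepsilon)=\lambda_G(\varepsilon)\quad(h\le\varepsilon\le g), \] where $\lambda_G$ is continuous and piecewise continuously differentiable on $[h,g]$. Put $\kappa_d=-\operatorname{vol}(G)$. Let $\zeta(s)=\dfrac{1}{1-\sum_j r_j^s}$ be the meromorphic continuation to $\mathbb{C}$ of the scaling zeta function $\sum_{k\ge0}\sum_{w\in\{1,\dots,J\}^k}(r_{w_1}\cdots r_{w_k})^s$ ($\operatorname{Re}s>D$), let $\mathfrak D$ be the set of its poles, let $\mathfrak D_{\mathcal T}=\mathfrak D\cup\{0,1,\dots,d-1\}$, and for $\varepsilon>0$ define \[ \zeta_{\mathcal T}(s,\varepsilon)=\zeta(s)\,\varepsilon^{d-s}\Bigl(\sum_{i=0}^{d-1}\frac{h^{s-i}}{s-i}\kappa_i+\frac{g^{s-d}}{s-d}\kappa_d+\Lambda(s)\Bigr),\qquad \Lambda(s)=\int_h^g u^{s-d-1}\lambda_G(u)\,du . \] Then, for every $0<\varepsilon<h$, the series $V_{\mathcal T}(\varepsilon)$ converges and \[ V_{\mathcal T}(\varepsilon)=\sum_{\omega\in\mathfrak D_{\mathcal T}}\operatorname{res}\bigl(\zeta_{\mathcal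 T}(s,\varepsilon);\omega\bigr), \] where the sum is understood as follows: each set $\{\omega\in\mathfrak D_{\mathcal T}:|\operatorname{Im}\omega|\le t\}$ is finite, and there is a strictly increasing sequence $\tau_n\to\infty$, not depending on $\varepsilon$, such that the sum is the limit as $n\to\infty$ of the finite sums over $\omega\in\mathfrak D_{\mathcal T}$ with $|\operatorname{Im}\omega|\le\tau_n$. -/

import Mathlib

open Filter Topology MeasureTheory

noncomputable section

/-- Euclidean space `ℝ^d`. -/
abbrev Euc (d : ℕ) : Type := EuclideanSpace ℝ (Fin d)

/-- The set map `A ↦ Φ_1(A) ∪ ⋯ ∪ Φ_J(A)` of a system of maps. -/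
def hutchinson {d J : ℕ} (Φ : Fin J → Euc d → Euc d) (A : Set (Euc d)) : Set (Euc d) :=
  ⋃ j, Φ j '' A

/-- `F` is a self-similar fractal: the nonempty compact invariant set of a system of similitudes
`Φ_j` with scaling ratios `r_j ∈ (0,1)`. -/
structure IsSelfSimilar {d J : ℕ} (Φ : Fin J → Euc d → Euc d) (r : Fin J → ℝ)
    (F : Set (Euc d)) : Prop where
  ratio_pos : ∀ j, 0 < r j
  ratio_lt_one : ∀ j, r j < 1
  similitude : ∀ j x y, dist (Φ j x) (Φ j y) = r j * dist x y
  nonempty : F.Nonempty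
  isCompact : IsCompact F
  invariant : F = hutchinson Φ F

/-- The tileset condition for `C`: the open set condition with `interior C` as a feasible
open set. -/
def TilesetCondition {d J : ℕ} (Φ : Fin J → Euc d → Euc d) (C : Set (Euc d)) : Prop :=
  (∀ j, Φ j '' interior C ⊆ interior C) ∧
    ∀ i j, i ≠ j → Disjoint (Φ i '' interior C) (Φ j '' interior C)

/-- The non-triviality condition for `C`. -/
def Nontriviality {d J : ℕ} (Φ : Fin J → Euc d → Euc d) (C : Set (Euc d)) : Prop :=
  ¬ interior C ⊆ hutchinson Φ C

/-- The sets of the tiling; `tile Φ C n` is `T_{n+1} = Φ^n (T_1)` with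
`T_1 = interior (C \ Φ(C))`. -/
def tile {d J : ℕ} (Φ : Fin J → Euc d → Euc d) (C : Set (Euc d)) (n : ℕ) : Set (Euc d) :=
  (hutchinson Φ)^[n] (interior (C \ hutchinson Φ C))

/-- The volume `V_A(ε)` of the inner `ε`-neighborhood of `A`, the set of the points of `A` whose
distance to the complement of `A` is at most `ε`. -/
def innerTubeVolume {d : ℕ} (A : Set (Euc d)) (ε : ℝ) : ℝ :=
  (volume : Measure (Euc d)).real {x | x ∈ A ∧ Metric.infDist x Aᶜ ≤ ε}

/-- The volume `V_𝒯(ε) = ∑ₙ V_{T_n}(ε)` of the inner `ε`-neighborhood of the tiling. -/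
def tilingTubeVolume {d J : ℕ} (Φ : Fin J → Euc d → Euc d) (C : Set (Euc d)) (ε : ℝ) : ℝ :=
  ∑' n, innerTubeVolume (tile Φ C n) ε

/-- The inradius: supremum of the radii of the balls contained in `A`. -/
def inradius {d : ℕ} (A : Set (Euc d)) : ℝ :=
  sSup {ρ : ℝ | 0 < ρ ∧ ∃ x, Metric.ball x ρ ⊆ A}

/-- `f` is continuous on `[a,b]`, and `[a,b]` is divided by finitely many points into closed
intervals on each of which `f` is continuously differentiable (one-sidedly at the ends). -/
def PiecewiseC1On (f : ℝ → ℝ) (a b : ℝ) : Prop :=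
  ContinuousOn f (Set.Icc a b) ∧
    ∃ (n : ℕ) (t : ℕ → ℝ), t 0 = a ∧ t n = b ∧
      ∀ i < n, t i < t (i + 1) ∧ ContDiffOn ℝ 1 f (Set.Icc (t i) (t (i + 1)))

/-- The Dirichlet series `∑_k ∑_{w ∈ W_k} r_w^s` over all words, where
`r_w = r_{w_1} ⋯ r_{w_k}`. -/
def scalingZetaSeries {J : ℕ} (r : Fin J → ℝ) (s : ℂ) : ℂ :=
  ∑' k : ℕ, ∑ w : Fin k → Fin J, ((∏ i, r (w i) : ℝ) : ℂ) ^ s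

/-- The scaling `ζ`-function as a meromorphic function on `ℂ`: the meromorphic continuation of
`scalingZetaSeries` (see `meromorphicOn_scalingZeta` and `hasSum_scalingZeta`). -/
def scalingZeta {J : ℕ} (r : Fin J → ℝ) (s : ℂ) : ℂ :=
  (1 - ∑ j, (r j : ℂ) ^ s)⁻¹

theorem meromorphicOn_scalingZeta {J : ℕ} (r : Fin J → ℝ) (hr : ∀ j, 0 < r j) :
    MeromorphicOn (scalingZeta r) Set.univ := by
  have h : Differentiable ℂ (fun s : ℂ => 1 - ∑ j, (r j : ℂ) ^ s) := by
    refine (differentiable_const _).sub (Differentiable.fun_sum fun j _ => ?_)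
    exact differentiable_id.const_cpow (Or.inl (by exact_mod_cast (hr j).ne'))
  intro z _
  exact (h.analyticAt z).meromorphicAt.inv

theorem hasSum_scalingZeta {J : ℕ} (r : Fin J → ℝ) (hr : ∀ j, 0 < r j) (hr1 : ∀ j, r j < 1)
    {D : ℝ} (hD : ∑ j, r j ^ D = 1) {s : ℂ} (hs : D < s.re) :
    HasSum (fun k : ℕ => ∑ w : Fin k → Fin J, ((∏ i, r (w i) : ℝ) : ℂ) ^ s)
      (scalingZeta r s) := by
  have hne : (Finset.univ : Finset (Fin J)).Nonempty := by
    by_contra h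
    rw [Finset.not_nonempty_iff_eq_empty] at h
    simp [h] at hD
  have hlt : ‖∑ j, (r j : ℂ) ^ s‖ < 1 := by
    refine (norm_sum_le _ _).trans_lt ?_
    rw [← hD]
    refine Finset.sum_lt_sum_of_nonempty hne fun j _ => ?_
    rw [Complex.norm_cpow_eq_rpow_re_of_pos (hr j)]
    exact Real.rpow_lt_rpow_of_exponent_gt (hr j) (hr1 j) hs
  have key : ∀ k : ℕ, ∑ w : Fin k → Fin J, ((∏ i, r (w i) : ℝ) : ℂ) ^ s
      = (∑ j, (r j : ℂ) ^ s) ^ k := by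
    intro k
    rw [Fintype.sum_pow]
    refine Finset.sum_congr rfl fun w _ => ?_
    rw [Complex.ofReal_prod]
    induction k with
    | zero => simp
    | succ k ih =>
      rw [Fin.prod_univ_succ, Fin.prod_univ_succ, ← ih (fun i => w i.succ) (Finset.mem_univ _),
        ← Complex.ofReal_prod,
        Complex.mul_cpow_ofReal_nonneg (hr _).le (Finset.prod_nonneg fun i _ => (hr _).le)]
  simp only [key]
  exact hasSum_geometric_of_norm_lt_one hlt

/-- On the half-plane `Re s > D` the function `scalingZeta` is the Dirichlet series. -/
theorem scalingZeta_eq_series {J : ℕ} (r : Fin J → ℝ) (hr : ∀ j, 0 < r j)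
    (hr1 : ∀ j, r j < 1) {D : ℝ} (hD : ∑ j, r j ^ D = 1) {s : ℂ} (hs : D < s.re) :
    scalingZetaSeries r s = scalingZeta r s :=
  (hasSum_scalingZeta r hr hr1 hD hs).tsum_eq

/-- The complex dimensions: the poles of the scaling `ζ`-function. -/
def complexDimensions {J : ℕ} (r : Fin J → ℝ) : Set ℂ :=
  {ω | meromorphicOrderAt (scalingZeta r) ω < 0}

/-- `𝔇_𝒯 = 𝔇 ∪ {0, 1, …, d-1}`. -/
def tilingDimensions {J : ℕ} (d : ℕ) (r : Fin J → ℝ) : Set ℂ :=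
  complexDimensions r ∪ {ω | ∃ i : ℕ, i < d ∧ ω = i}

/-- `Λ(s) = ∫_h^g u^{s-d-1} λ(u) du`. -/
def Lam (d : ℕ) (h g : ℝ) (lam : ℝ → ℝ) (s : ℂ) : ℂ :=
  ∫ u in h..g, (u : ℂ) ^ (s - d - 1) * (lam u : ℂ)

/-- The geometric `ζ`-function
`ζ(s) ε^{d-s} (∑_{i<d} κ_i h^{s-i}/(s-i) + κ_d g^{s-d}/(s-d) + Λ(s))`. -/
def geometricZeta {J : ℕ} (d : ℕ) (r : Fin J → ℝ) (κ : ℕ → ℝ) (h g : ℝ) (lam : ℝ → ℝ)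
    (ε : ℝ) (s : ℂ) : ℂ :=
  scalingZeta r s * (ε : ℂ) ^ ((d : ℂ) - s) *
    ((∑ i ∈ Finset.range d, (h : ℂ) ^ (s - i) / (s - i) * (κ i : ℂ)) +
      (g : ℂ) ^ (s - d) / (s - d) * (κ d : ℂ) + Lam d h g lam s)

/-- The residue of `f` at `ω`: the value of `(2πi)⁻¹ ∮ f` over small circles around `ω`
(for `f` meromorphic at `ω` it does not depend on the small radius). -/
def residue (f : ℂ → ℂ) (ω : ℂ) : ℂ :=
  limUnder (𝓝[>] (0 : ℝ)) fun ρ => (2 * Real.pi * Complex.I)⁻¹ * ∮ z in C(ω, ρ), f z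

end

/-! Scaling and disjointness give V_{T_{n+1}}(ε) = ∑_j r_j^d V_{T_n}(ε/r_j)
(`innerTubeVolume_tile_succ`). Under the Mellin transform evaluated at s - d, this recursion becomes
multiplication by ∑_j r_j^s. For d-1 < Re s < d the transform of V_G at s - d is the bracket in ζ_𝒯
(`mellin_eq_tubeTransform`). Mellin inversion on a line Re s = c with D < c < d, where the geometric
series sums to ζ(s), shows that V_𝒯(ε) converges and equals (2πi)⁻¹ times the integral of ζ_𝒯(·, ε)
over that line (`hasSum_iterate`).

The line is then pushed to -∞ by the residue theorem on [-R, c] × [-τ, τ], with R → ∞ before τ → ∞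
(`norm_sum_residue_sub_integral_le`). Away from the poles ζ_𝒯 is of size (h/ε)^{Re s}/|s - d|. As ε
< h, the left side disappears and no remainder is left; the horizontal sides are O(1/τ).

Three facts carry the estimates. Integration by parts (`tubeTransform_eq`) gives the factor 1/|s -
d|; its boundary terms cancel because V_G is continuous, which holds since level sets of a distance
function are null. The decay 1/|s| alone is not integrable on the line, but by Plancherel the
transform of λ' is square integrable there, and so is 1/(s - d) (`integrable_tubeTransform_line`).
Finally, 1 - ∑_j r_j^s is almost periodic in the vertical direction, so it stays away from zero on a
sequence of heights τ_n (`exists_heights_le_norm_scalingDenom`). -/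

/-! ### Similitudes of Euclidean space -/

/-- A similitude of `ℝ^d` is a translate of a scaled linear isometry. -/
theorem exists_linearIsometryEquiv_of_similitude {d : ℕ} {f : Euc d → Euc d} {r : ℝ} (hr : 0 < r)
    (hf : ∀ x y, dist (f x) (f y) = r * dist x y) :
    ∃ L : Euc d ≃ₗᵢ[ℝ] Euc d, ∀ x, f x = r • L x + f 0 := by
  -- After rescaling the map is an isometry, and an isometry into a strictly convex space is affine,
  -- surjective or not. Equality of dimensions then makes the linear part an equivalence.
  have hiso : Isometry (fun x => r⁻¹ • f x) := by
    refine Isometry.of_dist_eq fun x y => ?_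
    rw [dist_smul₀, hf, Real.norm_eq_abs, abs_of_pos (inv_pos.2 hr), inv_mul_cancel_left₀ hr.ne']
  let A := hiso.affineIsometryOfStrictConvexSpace
  refine ⟨A.linearIsometry.toLinearIsometryEquiv rfl, fun x => ?_⟩
  have h1 : A x = A.linearIsometry x + A 0 := by
    have := A.map_vadd 0 x
    simpa using this
  have h2 : ∀ x, A x = r⁻¹ • f x := fun x => by
    change hiso.affineIsometryOfStrictConvexSpace x = _
    rw [hiso.coe_affineIsometryOfStrictConvexSpace]
  rw [h2, h2] at h1
  have h3 := congrArg (fun y => r • y) h1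
  simpa [smul_smul, hr.ne'] using h3

section Similitude

variable {d : ℕ} {f : Euc d → Euc d} {r : ℝ}

/-- Surjectivity matters because inner tubes involve complements: it gives f(Aᶜ) = f(A)ᶜ. -/
theorem similitude_bijective (hr : 0 < r) (hf : ∀ x y, dist (f x) (f y) = r * dist x y) :
    Function.Bijective f := by
  obtain ⟨L, hL⟩ := exists_linearIsometryEquiv_of_similitude hr hf
  refine ⟨fun x y hxy => ?_, fun y => ⟨L.symm (r⁻¹ • (y - f 0)), ?_⟩⟩
  · have := hf x y
    rw [hxy, dist_self] at this
    exact dist_eq_zero.1 ((mul_eq_zero.1 this.symm).resolve_left hr.ne')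
  · rw [hL]
    simp [smul_smul, hr.ne']

open Pointwise in
theorem similitude_image_eq (hr : 0 < r) (hf : ∀ x y, dist (f x) (f y) = r * dist x y) :
    ∃ L : Euc d ≃ₗᵢ[ℝ] Euc d, ∀ A : Set (Euc d),
      f '' A = (fun x => x + f 0) '' (r • (L '' A)) := by
  obtain ⟨L, hL⟩ := exists_linearIsometryEquiv_of_similitude hr hf
  refine ⟨L, fun A => ?_⟩
  rw [← Set.image_smul, Set.image_image, Set.image_image]
  exact Set.image_congr fun x _ => hL x

open Pointwise in
theorem isOpen_similitude_image (hr : 0 < r) (hf : ∀ x y, dist (f x) (f y) = r * dist x y)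
    {A : Set (Euc d)} (hA : IsOpen A) : IsOpen (f '' A) := by
  obtain ⟨L, hL⟩ := similitude_image_eq hr hf
  rw [hL]
  exact (Homeomorph.addRight (f 0)).isOpenMap _
    ((L.toHomeomorph.isOpenMap _ hA).smul₀ hr.ne')

open Pointwise in
theorem volume_real_similitude_image (hr : 0 < r)
    (hf : ∀ x y, dist (f x) (f y) = r * dist x y) (A : Set (Euc d)) :
    (volume : Measure (Euc d)).real (f '' A) = r ^ d * (volume : Measure (Euc d)).real A := by
  obtain ⟨L, hL⟩ := similitude_image_eq hr hf
  have hvol : (volume : Measure (Euc d)) (L '' A) = volume A := by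
    have := L.symm.measurePreserving.measure_preimage_equiv (f := L.symm.toMeasurableEquiv) A
    rw [← this]
    congr 1
    ext x
    constructor
    · rintro ⟨y, hy, rfl⟩
      simpa using hy
    · exact fun hx => ⟨L.symm x, hx, by simp⟩
  rw [hL, measureReal_def, Set.image_add_right, measure_preimage_add_right, Measure.addHaar_smul,
    hvol, measureReal_def, ENNReal.toReal_mul, finrank_euclideanSpace_fin,
    abs_of_pos (pow_pos hr d), ENNReal.toReal_ofReal (pow_pos hr d).le]

open Pointwise in
theorem infDist_similitude_image (hr : 0 < r) (hf : ∀ x y, dist (f x) (f y) = r * dist x y)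
    (A : Set (Euc d)) (x : Euc d) :
    Metric.infDist (f x) (f '' A) = r * Metric.infDist x A := by
  obtain ⟨L, hL⟩ := exists_linearIsometryEquiv_of_similitude hr hf
  have h1 : f '' A = (fun x => x + f 0) '' (r • (L '' A)) := by
    rw [← Set.image_smul, Set.image_image, Set.image_image]
    exact Set.image_congr fun x _ => hL x
  rw [h1, hL x, Metric.infDist_image (Φ := fun x => x + f 0) (isometry_add_right _),
    infDist_smul₀ hr.ne', Metric.infDist_image L.isometry, Real.norm_eq_abs, abs_of_pos hr]

/-- The inner tube of the image of a set under a similitude. -/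
theorem innerTube_similitude_image (hr : 0 < r) (hf : ∀ x y, dist (f x) (f y) = r * dist x y)
    (A : Set (Euc d)) (ε : ℝ) :
    {x | x ∈ f '' A ∧ Metric.infDist x (f '' A)ᶜ ≤ ε} =
      f '' {x | x ∈ A ∧ Metric.infDist x Aᶜ ≤ ε / r} := by
  have hbij := similitude_bijective hr hf
  ext y
  obtain ⟨x, rfl⟩ := hbij.2 y
  rw [hbij.1.mem_set_image, Set.mem_ofPred_eq, hbij.1.mem_set_image, ← Set.image_compl_eq hbij,
    infDist_similitude_image hr hf, Set.mem_ofPred_eq, le_div_iff₀' hr]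

theorem innerTubeVolume_similitude_image (hr : 0 < r)
    (hf : ∀ x y, dist (f x) (f y) = r * dist x y) (A : Set (Euc d)) (ε : ℝ) :
    innerTubeVolume (f '' A) ε = r ^ d * innerTubeVolume A (ε / r) := by
  rw [innerTubeVolume, innerTube_similitude_image hr hf, volume_real_similitude_image hr hf,
    innerTubeVolume]

end Similitude

/-! ### Inner tubes of disjoint unions -/

/-- The distance from x to the complement of `U i` is attained on the frontier of `U i`. An open set
disjoint from `U i` also misses its closure, so that frontier point lies in no `U j`. -/
theorem infDist_compl_iUnion_of_disjoint {d : ℕ} {ι : Type*} {U : ι → Set (Euc d)}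
    (hU : ∀ i, IsOpen (U i)) (hdisj : Pairwise fun i j => Disjoint (U i) (U j))
    (hne : (⋃ i, U i) ≠ Set.univ) {i : ι} {x : Euc d} (hx : x ∈ U i) :
    Metric.infDist x (⋃ i, U i)ᶜ = Metric.infDist x (U i)ᶜ := by
  have hne' : U i ≠ Set.univ := fun h =>
    hne (Set.eq_univ_of_univ_subset (h ▸ Set.subset_iUnion U i))
  apply le_antisymm
  · obtain ⟨y, hy, hxy⟩ := exists_mem_frontier_infDist_compl_eq_dist hx hne'
    rw [hxy]
    refine Metric.infDist_le_dist_of_mem ?_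
    simp only [Set.mem_compl_iff, Set.mem_iUnion, not_exists]
    intro j hj
    rw [(hU i).frontier_eq] at hy
    rcases eq_or_ne i j with rfl | hij
    · exact hy.2 hj
    · obtain ⟨z, hz1, hz2⟩ := mem_closure_iff.1 hy.1 _ (hU j) hj
      exact (Set.disjoint_left.1 (hdisj hij) hz2 hz1)
  · refine Metric.infDist_le_infDist_of_subset
      (Set.compl_subset_compl.2 (Set.subset_iUnion U i)) ?_
    rwa [Set.nonempty_compl]

theorem measurableSet_innerTube {d : ℕ} {A : Set (Euc d)} (hA : MeasurableSet A) (ε : ℝ) :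
    MeasurableSet {x | x ∈ A ∧ Metric.infDist x Aᶜ ≤ ε} :=
  hA.inter (measurableSet_le (Metric.continuous_infDist_pt _).measurable measurable_const)

theorem innerTubeVolume_iUnion_of_disjoint {d : ℕ} {ι : Type*} [Fintype ι] {U : ι → Set (Euc d)}
    (hU : ∀ i, IsOpen (U i)) (hdisj : Pairwise fun i j => Disjoint (U i) (U j))
    (hne : (⋃ i, U i) ≠ Set.univ) (hfin : ∀ i, volume (U i) ≠ ⊤) (ε : ℝ) :
    innerTubeVolume (⋃ i, U i) ε = ∑ i, innerTubeVolume (U i) ε := by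
  have h : {x | x ∈ (⋃ i, U i) ∧ Metric.infDist x (⋃ i, U i)ᶜ ≤ ε} =
      ⋃ i, {x | x ∈ U i ∧ Metric.infDist x (U i)ᶜ ≤ ε} := by
    ext x
    simp only [Set.mem_ofPred_eq, Set.mem_iUnion]
    constructor
    · rintro ⟨⟨i, hi⟩, hx⟩
      exact ⟨i, hi, (infDist_compl_iUnion_of_disjoint hU hdisj hne hi) ▸ hx⟩
    · rintro ⟨i, hi, hx⟩
      exact ⟨⟨i, hi⟩, (infDist_compl_iUnion_of_disjoint hU hdisj hne hi).symm ▸ hx⟩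
  rw [innerTubeVolume, h, measureReal_iUnion_fintype
    (fun i j hij => (hdisj hij).mono (fun x hx => hx.1) (fun x hx => hx.1))
    (fun i => measurableSet_innerTube (hU i).measurableSet ε)
    (fun i => measure_ne_top_of_subset (fun x hx => hx.1) (hfin i))]
  rfl

/-- The functional equation of the inner tube volume under the set map of a system of similitudes
satisfying the tileset condition. -/
theorem innerTubeVolume_hutchinson {d J : ℕ} {Φ : Fin J → Euc d → Euc d} {r : Fin J → ℝ}
    (hr : ∀ j, 0 < r j) (hΦ : ∀ j x y, dist (Φ j x) (Φ j y) = r j * dist x y)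
    {C A : Set (Euc d)} (htile : TilesetCondition Φ C) (hC : Bornology.IsBounded C)
    (hd : 0 < d) (hA : IsOpen A) (hAC : A ⊆ interior C) (ε : ℝ) :
    innerTubeVolume (hutchinson Φ A) ε = ∑ j, r j ^ d * innerTubeVolume A (ε / r j) := by
  have hsub : ∀ j, Φ j '' A ⊆ C := fun j =>
    (Set.image_mono hAC).trans ((htile.1 j).trans interior_subset)
  rw [hutchinson, innerTubeVolume_iUnion_of_disjoint]
  · exact Finset.sum_congr rfl fun j _ => innerTubeVolume_similitude_image (hr j) (hΦ j) A ε
  · exact fun j => isOpen_similitude_image (hr j) (hΦ j) hA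
  · exact fun i j hij => (htile.2 i j hij).mono (Set.image_mono hAC) (Set.image_mono hAC)
  · intro h
    have : Nonempty (Fin d) := ⟨⟨0, hd⟩⟩
    have hb : Bornology.IsBounded (Set.univ : Set (Euc d)) :=
      h ▸ hC.subset (Set.iUnion_subset hsub)
    exact NormedSpace.unbounded_univ ℝ (Euc d) hb
  · exact fun j => (hC.subset (hsub j)).measure_lt_top.ne

theorem isOpen_tile {d J : ℕ} {Φ : Fin J → Euc d → Euc d} {r : Fin J → ℝ}
    (hr : ∀ j, 0 < r j) (hΦ : ∀ j x y, dist (Φ j x) (Φ j y) = r j * dist x y)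
    (C : Set (Euc d)) (n : ℕ) : IsOpen (tile Φ C n) := by
  induction n with
  | zero => exact isOpen_interior
  | succ n ih =>
    rw [tile, Function.iterate_succ_apply']
    exact isOpen_iUnion fun j => isOpen_similitude_image (hr j) (hΦ j) ih

/-- Keeps every tile inside the feasible open set, so that the disjointness in the tileset condition
is available at each iteration. -/
theorem tile_subset_interior {d J : ℕ} {Φ : Fin J → Euc d → Euc d} {C : Set (Euc d)}
    (htile : TilesetCondition Φ C) (n : ℕ) : tile Φ C n ⊆ interior C := by
  induction n with
  | zero => exact interior_mono Set.sdiff_subset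
  | succ n ih =>
    rw [tile, Function.iterate_succ_apply']
    exact Set.iUnion_subset fun j => (Set.image_mono ih).trans (htile.1 j)

theorem innerTubeVolume_tile_succ {d J : ℕ} {Φ : Fin J → Euc d → Euc d} {r : Fin J → ℝ}
    (hr : ∀ j, 0 < r j) (hΦ : ∀ j x y, dist (Φ j x) (Φ j y) = r j * dist x y)
    {C : Set (Euc d)} (htile : TilesetCondition Φ C) (hC : Bornology.IsBounded C)
    (hd : 0 < d) (n : ℕ) (ε : ℝ) :
    innerTubeVolume (tile Φ C (n + 1)) ε =
      ∑ j, r j ^ d * innerTubeVolume (tile Φ C n) (ε / r j) := by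
  rw [tile, Function.iterate_succ_apply']
  exact innerTubeVolume_hutchinson hr hΦ htile hC hd (isOpen_tile hr hΦ C n)
    (tile_subset_interior htile n) ε

/-! ### Regularity of the inner tube volume -/

/-- The positive level sets of the distance to a nonempty closed set are null. -/
theorem volume_infDist_level_eq_zero {d : ℕ} {S : Set (Euc d)} (hS : IsClosed S)
    (hne : S.Nonempty) {x₀ : ℝ} (hx₀ : 0 < x₀) :
    (volume : Measure (Euc d)) {x | Metric.infDist x S = x₀} = 0 := by
  set L : Set (Euc d) := {x | Metric.infDist x S = x₀} with hL
  have hLm : MeasurableSet L :=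
    measurableSet_eq_fun (Metric.continuous_infDist_pt _).measurable measurable_const
  -- The parameter 2 admits balls of radius δ whose centre is at distance up to 2δ from the density
  -- point.
  have hdens := IsUnifLocDoublingMeasure.ae_tendsto_measure_inter_div
    (volume : Measure (Euc d)) L 2
  rw [ae_restrict_iff' hLm] at hdens
  have hnot : ∀ᵐ x ∂(volume : Measure (Euc d)), x ∉ L := by
    filter_upwards [hdens] with x hx hxL
    obtain ⟨y, hyS, hxy⟩ := hS.exists_infDist_eq_dist hne x
    have hdist : dist x y = x₀ := by rw [← hxy]; exact hxL
    -- The centre is moved by exactly 2δ towards a nearest point y of S. Every point of the ball is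
    -- then within δ + (x₀ - 2δ) < x₀ of y, so the ball misses the level set, and the density is 0
    -- instead of 1.
    have hlim := hx hxL (l := 𝓝[>] (0 : ℝ)) (fun δ => x + (2 * δ / x₀) • (y - x)) (fun δ => δ)
      tendsto_id ?_
    · have hzero : (fun δ : ℝ => volume (L ∩ Metric.closedBall (x + (2 * δ / x₀) • (y - x)) δ) /
          volume (Metric.closedBall (x + (2 * δ / x₀) • (y - x)) δ)) =ᶠ[𝓝[>] (0 : ℝ)]
          fun _ => 0 := by
        have h1 : ∀ᶠ δ : ℝ in 𝓝[>] (0 : ℝ), δ < x₀ / 2 :=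
          mem_nhdsWithin_of_mem_nhds (Iio_mem_nhds (by positivity))
        filter_upwards [h1, self_mem_nhdsWithin] with δ hδ hδ0
        have hδ0' : 0 < δ := hδ0
        have : L ∩ Metric.closedBall (x + (2 * δ / x₀) • (y - x)) δ = ∅ := by
          rw [Set.eq_empty_iff_forall_notMem]
          rintro z ⟨hzL, hz⟩
          have hcy : dist (x + (2 * δ / x₀) • (y - x)) y = x₀ - 2 * δ := by
            have : x + (2 * δ / x₀) • (y - x) - y = (1 - 2 * δ / x₀) • (x - y) := by
              module
            rw [dist_eq_norm, this, norm_smul, ← dist_eq_norm x y, hdist, Real.norm_eq_abs,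
              abs_of_nonneg]
            · field_simp
            · rw [sub_nonneg, div_le_one hx₀]; linarith
          have h2 : dist z y ≤ δ + (x₀ - 2 * δ) := by
            rw [← hcy]
            exact (dist_triangle _ _ _).trans (by gcongr; exact hz)
          have h3 : Metric.infDist z S ≤ dist z y := Metric.infDist_le_dist_of_mem hyS
          have h4 : Metric.infDist z S = x₀ := hzL
          linarith
        rw [this, measure_empty, ENNReal.zero_div]
      have := tendsto_nhds_unique (hlim.congr' hzero) tendsto_const_nhds
      exact one_ne_zero this
    · filter_upwards [self_mem_nhdsWithin] with δ hδ
      have hδ' : 0 < δ := hδ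
      rw [Metric.mem_closedBall, dist_eq_norm, sub_add_cancel_left, norm_neg, norm_smul,
        ← dist_eq_norm, dist_comm y x, hdist, Real.norm_eq_abs, abs_of_pos (by positivity)]
      exact (by field_simp : 2 * δ / x₀ * x₀ = 2 * δ).le
  simpa [ae_iff] using hnot

/-- Dominated convergence: as x → x₀ the indicators of the tubes converge off the level set at
distance x₀, which is null. -/
theorem continuousAt_innerTubeVolume {d : ℕ} {A : Set (Euc d)} (hA : IsOpen A)
    (hfin : volume A ≠ ⊤) (hne : A ≠ Set.univ) {x₀ : ℝ} (hx₀ : 0 < x₀) :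
    ContinuousAt (innerTubeVolume A) x₀ := by
  have hlevel := volume_infDist_level_eq_zero (S := Aᶜ) hA.isClosed_compl
    (Set.nonempty_compl.2 hne) hx₀
  have hrepr : ∀ x, innerTubeVolume A x =
      ∫ z in A, Set.indicator {z | Metric.infDist z Aᶜ ≤ x} (fun _ => (1 : ℝ)) z := by
    intro x
    rw [setIntegral_indicator
      (measurableSet_le (Metric.continuous_infDist_pt _).measurable measurable_const)]
    simp only [setIntegral_const, smul_eq_mul, mul_one]
    rfl
  have : Tendsto (fun x => ∫ z in A, Set.indicator {z | Metric.infDist z Aᶜ ≤ x}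
      (fun _ => (1 : ℝ)) z) (𝓝 x₀) (𝓝 (∫ z in A, Set.indicator {z | Metric.infDist z Aᶜ ≤ x₀}
      (fun _ => (1 : ℝ)) z)) := by
    refine tendsto_integral_filter_of_dominated_convergence (fun _ => 1) ?_ ?_ ?_ ?_
    · refine Eventually.of_forall fun x => ?_
      exact (stronglyMeasurable_const.indicator (measurableSet_le
        (Metric.continuous_infDist_pt _).measurable measurable_const)).aestronglyMeasurable
    · refine Eventually.of_forall fun x => Eventually.of_forall fun z => ?_
      by_cases hz : Metric.infDist z Aᶜ ≤ x <;> simp [hz]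
    · exact integrableOn_const hfin
    · have h1 : ∀ᵐ z ∂(volume : Measure (Euc d)), Metric.infDist z Aᶜ ≠ x₀ := by
        simpa [ae_iff] using hlevel
      filter_upwards [ae_restrict_of_ae h1] with z hz
      refine tendsto_const_nhds.congr' ?_
      rcases lt_or_gt_of_ne hz with h | h
      · filter_upwards [lt_mem_nhds h] with x hx
        simp [h.le, hx.le]
      · filter_upwards [gt_mem_nhds h] with x hx
        simp [h, hx]
  rw [ContinuousAt, hrepr x₀]
  exact this.congr fun x => (hrepr x).symm

theorem infDist_compl_le_inradius {d : ℕ} (hd : 0 < d) {A : Set (Euc d)} (hA : IsOpen A)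
    (hb : Bornology.IsBounded A) {x : Euc d} (hx : x ∈ A) :
    Metric.infDist x Aᶜ ≤ inradius A := by
  have : Nonempty (Fin d) := ⟨⟨0, hd⟩⟩
  have hne : Aᶜ.Nonempty := by
    rw [Set.nonempty_compl]
    rintro rfl
    exact NormedSpace.unbounded_univ ℝ (Euc d) hb
  -- The supremum needs a bound: a ball of radius ρ contains two points at distance ρ/2, so ρ/2 ≤
  -- diam A.
  refine le_csSup ⟨2 * Metric.diam A, ?_⟩ ⟨?_, x, ?_⟩
  · rintro ρ ⟨hρ, y, hy⟩
    obtain ⟨v, hv⟩ := exists_norm_eq (Euc d) (half_pos hρ).le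
    have h1 := Metric.dist_le_diam_of_mem hb (hy (Metric.mem_ball_self hρ))
      (hy (show y + v ∈ Metric.ball y ρ by simp [hv, hρ]))
    rw [dist_self_add_right, hv] at h1
    linarith
  · exact (hA.isClosed_compl.notMem_iff_infDist_pos hne).1 (fun h => h hx)
  · exact Metric.ball_infDist_compl_subset

theorem innerTubeVolume_eq_volume_of_inradius_le {d : ℕ} (hd : 0 < d) {A : Set (Euc d)}
    (hA : IsOpen A) (hb : Bornology.IsBounded A) {x : ℝ} (hx : inradius A ≤ x) :
    innerTubeVolume A x = (volume : Measure (Euc d)).real A := by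
  rw [innerTubeVolume]
  congr 1
  ext z
  exact ⟨fun h => h.1, fun h => ⟨h, (infDist_compl_le_inradius hd hA hb h).trans hx⟩⟩

/-! ### The Fourier transform of `L¹ ∩ L²` functions -/

open FourierTransform SchwartzMap in
/-- The Fourier integral of a function in `L¹ ∩ L²` is square integrable. -/
theorem memLp_two_fourier_of_integrable {f : ℝ → ℂ} (h1 : Integrable f) (h2 : MemLp f 2) :
    MemLp (𝓕 f : ℝ → ℂ) 2 := by
  -- `u` is the Plancherel transform, which is in L² by construction. It is identified with the
  -- Fourier integral by testing both against smooth compactly supported functions and moving the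
  -- transform onto the test function.
  set u : Lp ℂ 2 (volume : Measure ℝ) := 𝓕 (h2.toLp f) with hu
  have hcont : Continuous (𝓕 f : ℝ → ℂ) :=
    VectorFourier.fourierIntegral_continuous Real.continuous_fourierChar
      (by exact continuous_inner) h1
  have hae : ∀ᵐ x, (u : ℝ → ℂ) x = (𝓕 f : ℝ → ℂ) x := by
    refine ae_eq_of_integral_contDiff_smul_eq
      ((Lp.memLp u).locallyIntegrable (by norm_num)) hcont.locallyIntegrable ?_
    intro φ hφ hφs
    have hφ' : ContDiff ℝ (⊤ : ℕ∞) (fun x => (φ x : ℂ)) :=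
      Complex.ofRealCLM.contDiff.comp hφ
    have hφs' : HasCompactSupport (fun x => (φ x : ℂ)) :=
      hφs.comp_left (g := fun y : ℝ => (y : ℂ)) (by simp)
    let ψ : 𝓢(ℝ, ℂ) := hφs'.toSchwartzMap hφ'
    have hψ : ∀ x, ψ x = (φ x : ℂ) := fun x => rfl
    have key := DFunLike.congr_fun (Lp.fourier_toTemperedDistribution_eq (h2.toLp f)) ψ
    rw [TemperedDistribution.fourier_apply, Lp.toTemperedDistribution_apply,
      Lp.toTemperedDistribution_apply, ← hu] at key
    have e1 : ∫ x, φ x • (u : ℝ → ℂ) x = ∫ x, ψ x • (u : ℝ → ℂ) x := by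
      simp [hψ]
    have e2 : ∫ x, (𝓕 ψ) x • (h2.toLp f : ℝ → ℂ) x = ∫ x, (𝓕 (ψ : ℝ → ℂ)) x • f x := by
      refine integral_congr_ae ?_
      filter_upwards [h2.coeFn_toLp] with x hx
      rw [hx, SchwartzMap.fourier_coe]
    have e3 : ∫ x, (𝓕 (ψ : ℝ → ℂ)) x • f x = ∫ x, ψ x • (𝓕 f : ℝ → ℂ) x := by
      have := VectorFourier.integral_fourierIntegral_smul_eq_flip (μ := volume) (ν := volume)
        (L := innerₗ ℝ) (f := (ψ : ℝ → ℂ)) (g := f) Real.continuous_fourierChar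
        (by exact continuous_inner) ψ.integrable h1
      rw [flip_innerₗ] at this
      exact this
    rw [e1, ← key, e2, e3]
    simp [hψ]
  exact (Lp.memLp u).ae_eq hae

/-! ### Mellin transforms of functions supported in a compact subinterval of `(0, ∞)` -/

theorem mellin_indicator_Ioc {h g : ℝ} (hh : 0 < h) (hhg : h ≤ g) (φ : ℝ → ℂ) (s : ℂ) :
    mellin ((Set.Ioc h g).indicator φ) s = ∫ u in h..g, (u : ℂ) ^ (s - 1) * φ u := by
  rw [mellin, intervalIntegral.integral_of_le hhg]
  have : ∀ t : ℝ, (t : ℂ) ^ (s - 1) • (Set.Ioc h g).indicator φ t =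
      (Set.Ioc h g).indicator (fun u : ℝ => (u : ℂ) ^ (s - 1) * φ u) t := by
    intro t
    by_cases ht : t ∈ Set.Ioc h g <;> simp [ht]
  simp_rw [this]
  rw [setIntegral_indicator measurableSet_Ioc]
  congr 2
  ext t
  simp only [Set.mem_inter_iff, Set.mem_Ioi, Set.mem_Ioc]
  exact ⟨fun ht => ht.2, fun ht => ⟨hh.trans ht.1, ht⟩⟩

/-- The function vanishes near 0 and near ∞, so both growth conditions hold with constant 0 and any
exponents; those used are just chosen on either side of Re s. -/
theorem differentiable_mellin_indicator_Ioc {h g : ℝ} (hh : 0 < h) {φ : ℝ → ℂ}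
    (hφ : IntegrableOn φ (Set.Ioc h g)) :
    Differentiable ℂ (mellin ((Set.Ioc h g).indicator φ)) := by
  intro s
  refine mellin_differentiableAt_of_isBigO_rpow (a := s.re + 1) (b := s.re - 1) ?_ ?_
    (by linarith) ?_ (by linarith)
  · exact ((integrable_indicator_iff measurableSet_Ioc).2 hφ).locallyIntegrable.locallyIntegrableOn _
  · refine Asymptotics.IsBigO.of_bound 0 ?_
    filter_upwards [eventually_gt_atTop g] with x hx
    simp [hx]
  · refine Asymptotics.IsBigO.of_bound 0 ?_
    have : ∀ᶠ x : ℝ in 𝓝[>] 0, x < h := mem_nhdsWithin_of_mem_nhds (Iio_mem_nhds hh)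
    filter_upwards [this] with x hx
    simp [hx.le]

/-- On vertical lines, the Mellin transform of a bounded measurable function supported in a
compact subinterval of `(0, ∞)` is square integrable. -/
theorem integrable_sq_norm_mellin_indicator_Ioc {h g K : ℝ} (hh : 0 < h) {φ : ℝ → ℂ}
    (hφ : Measurable φ) (hK : ∀ u ∈ Set.Ioc h g, ‖φ u‖ ≤ K) (σ : ℝ) :
    Integrable fun t : ℝ => ‖mellin ((Set.Ioc h g).indicator φ) (σ + t * Complex.I)‖ ^ 2 := by
  -- Under the substitution e^{-u} the Mellin transform on Re = σ becomes the Fourier transform of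
  -- `ψ` at t/2π; `ψ` is bounded with compact support, hence in every L^p.
  set ψ : ℝ → ℂ := fun u => Real.exp (-σ * u) • (Set.Ioc h g).indicator φ (Real.exp (-u)) with hψ
  have hψm : Measurable ψ :=
    (by fun_prop : Measurable fun u : ℝ => Real.exp (-σ * u)).smul
      ((hφ.indicator measurableSet_Ioc).comp (by fun_prop))
  set I := Set.Icc (-Real.log g) (-Real.log h) with hI
  obtain ⟨B, hB⟩ := (isCompact_Icc (a := -Real.log g) (b := -Real.log h)).exists_bound_of_continuousOn
    (f := fun u : ℝ => Real.exp (-σ * u)) (by fun_prop)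
  have hψI : I.indicator ψ = ψ := by
    refine Set.indicator_eq_self.2 fun u hu => ?_
    by_contra hu'
    refine hu ?_
    have : Real.exp (-u) ∉ Set.Ioc h g := by
      rintro ⟨h1, h2⟩
      refine hu' ⟨?_, ?_⟩
      · have := (Real.le_log_iff_exp_le (hh.trans (h1.trans_le h2))).2 h2
        linarith
      · have := (Real.log_lt_iff_lt_exp hh).2 h1
        linarith
    simp [hψ, this]
  have hmem : ∀ p : ENNReal, MemLp ψ p := by
    intro p
    rw [← hψI, memLp_indicator_iff_restrict measurableSet_Icc]
    refine MemLp.of_bound hψm.aestronglyMeasurable (B * max K 0) ?_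
    filter_upwards [ae_restrict_mem measurableSet_Icc] with u hu
    rw [hψ, norm_smul]
    have hB' := hB u hu
    refine mul_le_mul hB' ?_ (norm_nonneg _) ((norm_nonneg _).trans hB')
    by_cases hu' : Real.exp (-u) ∈ Set.Ioc h g
    · simpa [hu'] using Or.inl (hK _ hu')
    · simp [hu']
  have hF := memLp_two_fourier_of_integrable (memLp_one_iff_integrable.1 (hmem 1)) (hmem 2)
  have hF2 := (memLp_two_iff_integrable_sq_norm hF.1).1 hF
  refine (hF2.comp_div (R := 2 * Real.pi) (by positivity)).congr ?_
  refine Eventually.of_forall fun t => ?_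
  simp [mellin_eq_fourier, hψ]

/-! ### Piecewise continuously differentiable functions -/

theorem exists_mem_Ioo_of_mem_Ioo_partition {t : ℕ → ℝ} {n : ℕ} {u : ℝ}
    (hu : u ∈ Set.Ioo (t 0) (t n)) (hut : ∀ i ≤ n, u ≠ t i) :
    ∃ i < n, u ∈ Set.Ioo (t i) (t (i + 1)) := by
  induction n with
  | zero => exact absurd (hu.1.trans hu.2) (lt_irrefl _)
  | succ n ih =>
    rcases lt_or_gt_of_ne (hut n (Nat.le_succ n)) with h | h
    · obtain ⟨i, hi, hui⟩ := ih ⟨hu.1, h⟩ fun i hi => hut i (hi.trans (Nat.le_succ n))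
      exact ⟨i, hi.trans (Nat.lt_succ_self n), hui⟩
    · exact ⟨n, Nat.lt_succ_self n, h, hu.2⟩

/-- A piecewise `C¹` function is differentiable off a finite set, with bounded derivative. -/
theorem PiecewiseC1On.exists_finite_differentiableAt {f : ℝ → ℝ} {a b : ℝ}
    (hf : PiecewiseC1On f a b) :
    (∃ S : Set ℝ, S.Finite ∧ ∀ u ∈ Set.Ioo a b \ S, DifferentiableAt ℝ f u) ∧
      ∃ K : ℝ, ∀ u ∈ Set.Icc a b, |deriv f u| ≤ K := by
  obtain ⟨-, n, t, rfl, rfl, ht⟩ := hf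
  have hS : (t '' Set.Iic n).Finite := (Set.finite_Iic n).image t
  have hpiece : ∀ u ∈ Set.Ioo (t 0) (t n) \ (t '' Set.Iic n),
      ∃ i < n, u ∈ Set.Ioo (t i) (t (i + 1)) := fun u hu =>
    exists_mem_Ioo_of_mem_Ioo_partition hu.1 fun i hi h => hu.2 ⟨i, hi, h.symm⟩
  refine ⟨⟨t '' Set.Iic n, hS, fun u hu => ?_⟩, ?_⟩
  · obtain ⟨i, hi, hui⟩ := hpiece u hu
    exact ((ht i hi).2.differentiableOn (by norm_num) u (Set.Ioo_subset_Icc_self hui)).differentiableAt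
      (Icc_mem_nhds hui.1 hui.2)
  · have hb : ∀ i : ℕ, ∃ B : ℝ, i < n → ∀ u ∈ Set.Ioo (t i) (t (i + 1)), |deriv f u| ≤ B := by
      intro i
      by_cases hi : i < n
      · obtain ⟨B, hB⟩ := isCompact_Icc.exists_bound_of_continuousOn
          ((ht i hi).2.continuousOn_derivWithin (uniqueDiffOn_Icc (ht i hi).1) le_rfl)
        refine ⟨B, fun _ u hu => ?_⟩
        have := hB u (Set.Ioo_subset_Icc_self hu)
        rwa [derivWithin_of_mem_nhds (Icc_mem_nhds hu.1 hu.2)] at this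
      · exact ⟨0, fun h => absurd h hi⟩
    choose B hB using hb
    obtain ⟨B₁, hB₁⟩ := ((Set.finite_Iio n).image B).bddAbove
    -- At a break point `deriv` may be a default value or depend on values outside [a, b]. There are
    -- only finitely many such values, so they are bounded separately.
    obtain ⟨B₂, hB₂⟩ := (hS.image fun u => |deriv f u|).bddAbove
    refine ⟨max B₁ B₂, fun u hu => ?_⟩
    by_cases huS : u ∈ t '' Set.Iic n
    · exact (hB₂ ⟨u, huS, rfl⟩).trans (le_max_right _ _)
    · have hne0 : u ≠ t 0 := fun h => huS ⟨0, Nat.zero_le n, h.symm⟩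
      have hnen : u ≠ t n := fun h => huS ⟨n, le_refl n, h.symm⟩
      obtain ⟨i, hi, hui⟩ := hpiece u
        ⟨⟨lt_of_le_of_ne hu.1 hne0.symm, lt_of_le_of_ne hu.2 hnen⟩, huS⟩
      exact (hB i hi u hui).trans ((hB₁ ⟨i, hi, rfl⟩).trans (le_max_left _ _))

/-! ### The Mellin transform of a monophase tube function -/

/-- `V` is polynomial on `(0, h)`, equal to the piecewise `C¹` function `lam` on `[h, g]`,
constant on `[g, ∞)`, and continuous on `(0, ∞)`. -/
structure IsTubeFunction (V : ℝ → ℝ) (d : ℕ) (κ : ℕ → ℝ) (h g : ℝ) (lam : ℝ → ℝ) : Prop where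
  d_pos : 0 < d
  h_pos : 0 < h
  h_lt_g : h < g
  continuousAt : ∀ x, 0 < x → ContinuousAt V x
  poly : ∀ x, 0 < x → x < h → V x = ∑ i ∈ Finset.range d, κ i * x ^ (d - i)
  eq_lam : ∀ x, h ≤ x → x ≤ g → V x = lam x
  piecewise : PiecewiseC1On lam h g
  eq_const : ∀ x, g ≤ x → V x = -κ d

/-- The Mellin transform of a tube function, continued meromorphically. -/
noncomputable def tubeTransform (d : ℕ) (κ : ℕ → ℝ) (h g : ℝ) (lam : ℝ → ℝ) (s : ℂ) : ℂ :=
  (∑ i ∈ Finset.range d, (h : ℂ) ^ (s - i) / (s - i) * (κ i : ℂ)) +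
    (g : ℂ) ^ (s - d) / (s - d) * (κ d : ℂ) + Lam d h g lam s

/-- `∫_h^g u^{s-d} λ'(u) du`. -/
noncomputable def derivTransform (d : ℕ) (h g : ℝ) (lam : ℝ → ℝ) (s : ℂ) : ℂ :=
  ∫ u in h..g, (u : ℂ) ^ (s - d) * ((deriv lam u : ℝ) : ℂ)

theorem continuousOn_cpow_const_Icc {h g : ℝ} (hh : 0 < h) (z : ℂ) :
    ContinuousOn (fun u : ℝ => (u : ℂ) ^ z) (Set.Icc h g) := fun u hu =>
  (Complex.continuousAt_ofReal_cpow_const u z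
    (Or.inr (hh.trans_le hu.1).ne')).continuousWithinAt

theorem integral_cpow_mul_eq_sub_derivTransform {d : ℕ} {h g : ℝ} {lam : ℝ → ℝ} (hh : 0 < h)
    (hhg : h < g) (hlam : PiecewiseC1On lam h g) {s : ℂ} (hs : s ≠ d) :
    Lam d h g lam s = ((g : ℂ) ^ (s - d) * lam g - (h : ℂ) ^ (s - d) * lam h -
      derivTransform d h g lam s) / (s - d) := by
  have hs' : s - d ≠ 0 := sub_ne_zero.2 hs
  obtain ⟨⟨S, hS, hdiff⟩, K, hK⟩ := hlam.exists_finite_differentiableAt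
  have hcont := hlam.1
  have hlamC : ContinuousOn (fun u : ℝ => (lam u : ℂ)) (Set.Icc h g) :=
    Complex.continuous_ofReal.comp_continuousOn hcont
  have hint1 : IntervalIntegrable (fun u : ℝ => (s - d) * ((u : ℂ) ^ (s - d - 1) * (lam u : ℂ)))
      volume h g := by
    refine ContinuousOn.intervalIntegrable_of_Icc hhg.le ?_
    exact continuousOn_const.mul ((continuousOn_cpow_const_Icc hh _).mul hlamC)
  have hint2 : IntervalIntegrable (fun u : ℝ => (u : ℂ) ^ (s - d) * ((deriv lam u : ℝ) : ℂ))
      volume h g := by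
    have hd : IntervalIntegrable (fun u : ℝ => ((deriv lam u : ℝ) : ℂ)) volume h g := by
      rw [intervalIntegrable_iff_integrableOn_Ioc_of_le hhg.le]
      refine Measure.integrableOn_of_bounded (M := K) (by simp)
        (Complex.measurable_ofReal.comp (measurable_deriv lam)).aestronglyMeasurable ?_
      filter_upwards [ae_restrict_mem measurableSet_Ioc] with u hu
      simpa using hK u (Set.Ioc_subset_Icc_self hu)
    refine hd.continuousOn_mul ?_
    rw [Set.uIcc_of_le hhg.le]
    exact continuousOn_cpow_const_Icc hh _
  have hFTC := integral_eq_of_hasDerivAt_off_countable_of_le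
    (fun u : ℝ => (u : ℂ) ^ (s - d) * (lam u : ℂ))
    (fun u : ℝ => (s - d) * ((u : ℂ) ^ (s - d - 1) * (lam u : ℂ)) +
      (u : ℂ) ^ (s - d) * ((deriv lam u : ℝ) : ℂ)) hhg.le hS.countable
    ((continuousOn_cpow_const_Icc hh _).mul hlamC) ?_ (hint1.add hint2)
  · rw [intervalIntegral.integral_add hint1 hint2, intervalIntegral.integral_const_mul] at hFTC
    rw [Lam, derivTransform, eq_div_iff hs', ← hFTC]
    ring
  · intro u hu
    have hu0 : 0 < u := hh.trans hu.1.1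
    have h1 : HasDerivAt (fun u : ℝ => (u : ℂ) ^ (s - d)) ((s - d) * (u : ℂ) ^ (s - d - 1)) u := by
      have := (hasDerivAt_id (u : ℂ)).cpow_const (c := s - d)
        (Or.inl (by simpa using hu0))
      simpa using this.comp_ofReal
    have h2 := (hdiff u hu).hasDerivAt.ofReal_comp
    refine (h1.mul h2).congr_deriv ?_
    ring

/-- The exponent Re s - d is nonpositive, so u^{Re s - d} is largest at u = h. This yields the
factor h^{Re s} that later competes with ε^{-Re s}. -/
theorem norm_derivTransform_le {d : ℕ} {h g K : ℝ} {lam : ℝ → ℝ} (hh : 0 < h)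
    (hhg : h < g) (hK : ∀ u ∈ Set.Icc h g, |deriv lam u| ≤ K) {s : ℂ} (hs : s.re ≤ d) :
    ‖derivTransform d h g lam s‖ ≤ h ^ (s.re - d) * K * (g - h) := by
  have := intervalIntegral.norm_integral_le_of_norm_le_const (a := h) (b := g)
    (f := fun u : ℝ => (u : ℂ) ^ (s - d) * ((deriv lam u : ℝ) : ℂ)) (C := h ^ (s.re - d) * K) ?_
  · rwa [abs_of_pos (sub_pos.2 hhg)] at this
  · intro u hu
    rw [Set.uIoc_of_le hhg.le] at hu
    rw [norm_mul, Complex.norm_cpow_eq_rpow_re_of_pos (hh.trans hu.1), Complex.norm_real]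
    refine mul_le_mul ?_ (hK u (Set.Ioc_subset_Icc_self hu)) (norm_nonneg _) (by positivity)
    simp only [Complex.sub_re, Complex.natCast_re]
    exact Real.rpow_le_rpow_of_nonpos hh hu.1.le (by linarith)

theorem differentiable_Lam {d : ℕ} {h g : ℝ} {lam : ℝ → ℝ} (hh : 0 < h)
    (hhg : h < g) (hlam : ContinuousOn lam (Set.Icc h g)) :
    Differentiable ℂ (Lam d h g lam) := by
  have hint : IntegrableOn (fun u : ℝ => (lam u : ℂ)) (Set.Ioc h g) :=
    ((Complex.continuous_ofReal.comp_continuousOn hlam).integrableOn_Icc).mono_set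
      Set.Ioc_subset_Icc_self
  have : Lam d h g lam = fun s => mellin ((Set.Ioc h g).indicator fun u : ℝ => (lam u : ℂ))
      (s - d) := by
    ext s
    rw [mellin_indicator_Ioc hh hhg.le, Lam]
  rw [this]
  exact (differentiable_mellin_indicator_Ioc hh hint).comp
    (differentiable_id.sub (differentiable_const _))

theorem integrable_inv_sq_add_sq {a : ℝ} (ha : a ≠ 0) :
    Integrable fun t : ℝ => (a ^ 2 + t ^ 2)⁻¹ := by
  refine ((integrable_inv_one_add_sq.comp_div ha).const_mul (a ^ 2)⁻¹).congr
    (Eventually.of_forall fun t => ?_)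
  simp only [← mul_inv]
  congr 1
  field_simp

namespace IsTubeFunction

variable {V : ℝ → ℝ} {d : ℕ} {κ : ℕ → ℝ} {h g : ℝ} {lam : ℝ → ℝ}

/-- Together with `lam_h` this is the matching of the pieces of V at g and h, which cancels the
boundary terms in `tubeTransform_eq`. -/
theorem lam_g (H : IsTubeFunction V d κ h g lam) : lam g = -κ d := by
  rw [← H.eq_lam g H.h_lt_g.le le_rfl, H.eq_const g le_rfl]

theorem lam_h (H : IsTubeFunction V d κ h g lam) :
    lam h = ∑ i ∈ Finset.range d, κ i * h ^ (d - i) := by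
  rw [← H.eq_lam h le_rfl H.h_lt_g.le]
  have h1 : Tendsto V (𝓝[<] h) (𝓝 (V h)) := (H.continuousAt h H.h_pos).mono_left nhdsWithin_le_nhds
  have h2 : Tendsto (fun x : ℝ => ∑ i ∈ Finset.range d, κ i * x ^ (d - i)) (𝓝[<] h)
      (𝓝 (∑ i ∈ Finset.range d, κ i * h ^ (d - i))) :=
    (Continuous.tendsto (by fun_prop) h).mono_left nhdsWithin_le_nhds
  refine tendsto_nhds_unique h1 (h2.congr' ?_)
  have h3 : ∀ᶠ x in 𝓝[<] h, 0 < x := mem_nhdsWithin_of_mem_nhds (Ioi_mem_nhds H.h_pos)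
  filter_upwards [h3, self_mem_nhdsWithin] with x hx hx'
  exact (H.poly x hx hx').symm

/-- Integration by parts: the boundary terms cancel by continuity of the tube function. -/
theorem tubeTransform_eq (H : IsTubeFunction V d κ h g lam) {s : ℂ}
    (hs : ∀ i ≤ d, s ≠ (i : ℕ)) :
    tubeTransform d κ h g lam s =
      (∑ i ∈ Finset.range d, (h : ℂ) ^ (s - i) / (s - i) * ((κ i : ℂ) * (i - d)) -
        derivTransform d h g lam s) / (s - d) := by
  have hsd : s - d ≠ 0 := sub_ne_zero.2 (hs d le_rfl)
  have hh0 : (h : ℂ) ≠ 0 := by exact_mod_cast H.h_pos.ne'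
  rw [tubeTransform, integral_cpow_mul_eq_sub_derivTransform H.h_pos H.h_lt_g H.piecewise
    (hs d le_rfl), H.lam_g, H.lam_h, eq_div_iff hsd, add_mul, add_mul, div_mul_cancel₀ _ hsd,
    Finset.sum_mul]
  -- Write s - d = (i - d) + (s - i). The second summand removes the denominator s - i and leaves
  -- h^{s-d} κ_i h^{d-i}; by `lam_h` these add up to the boundary term at h.
  have key : ∀ i ∈ Finset.range d, (h : ℂ) ^ (s - i) / (s - i) * (κ i : ℂ) * (s - d) =
      (h : ℂ) ^ (s - i) / (s - i) * ((κ i : ℂ) * (i - d)) +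
        (h : ℂ) ^ (s - d) * ((κ i : ℂ) * (h : ℂ) ^ (d - i)) := by
    intro i hi
    have hid : i < d := Finset.mem_range.1 hi
    have hsi : s - i ≠ 0 := sub_ne_zero.2 (hs i hid.le)
    have e : (h : ℂ) ^ (s - d) * (h : ℂ) ^ (d - i) = (h : ℂ) ^ (s - i) := by
      rw [← Complex.cpow_natCast, ← Complex.cpow_add _ _ hh0, Nat.cast_sub hid.le]
      congr 1
      ring
    rw [mul_left_comm ((h : ℂ) ^ (s - d)), e]
    field_simp
    ring
  rw [Finset.sum_congr rfl key, Finset.sum_add_distrib, ← Finset.mul_sum]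
  push_cast
  field_simp
  ring

/-- Decay of the transform away from its poles, in the half-plane `Re s ≤ d`. -/
theorem exists_norm_tubeTransform_le (H : IsTubeFunction V d κ h g lam) :
    ∃ K : ℝ, 0 ≤ K ∧ ∀ s : ℂ, s.re ≤ d → (∀ i ≤ d, 1 ≤ ‖s - (i : ℕ)‖) →
      ‖tubeTransform d κ h g lam s‖ ≤ K * h ^ s.re / ‖s - d‖ := by
  obtain ⟨-, K, hK⟩ := H.piecewise.exists_finite_differentiableAt
  have hh := H.h_pos
  have hK0 : 0 ≤ K := (abs_nonneg _).trans (hK h (Set.left_mem_Icc.2 H.h_lt_g.le))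
  have hgh : 0 ≤ g - h := (sub_pos.2 H.h_lt_g).le
  refine ⟨∑ i ∈ Finset.range d, h ^ (-(i : ℝ)) * ‖(κ i : ℂ) * (i - d)‖ +
    h ^ (-(d : ℝ)) * K * (g - h), by positivity, fun s hs hs1 => ?_⟩
  have hne : ∀ i ≤ d, s ≠ (i : ℕ) := fun i hi hsi => by
    have := hs1 i hi
    rw [hsi, sub_self, norm_zero] at this
    linarith
  rw [H.tubeTransform_eq hne, norm_div]
  gcongr
  refine (norm_sub_le _ _).trans ?_
  rw [add_mul]
  refine add_le_add ((norm_sum_le _ _).trans ?_) ?_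
  · rw [Finset.sum_mul]
    refine Finset.sum_le_sum fun i hi => ?_
    rw [norm_mul, norm_div, Complex.norm_cpow_eq_rpow_re_of_pos hh]
    have h1 := hs1 i (Finset.mem_range.1 hi).le
    have h2 : h ^ (s - (i : ℂ)).re = h ^ (-(i : ℝ)) * h ^ s.re := by
      rw [← Real.rpow_add hh]
      congr 1
      simp [sub_eq_neg_add]
    rw [h2]
    have h3 : h ^ (-(i : ℝ)) * h ^ s.re / ‖s - i‖ ≤ h ^ (-(i : ℝ)) * h ^ s.re :=
      div_le_self (by positivity) h1
    calc _ ≤ h ^ (-(i : ℝ)) * h ^ s.re * ‖(κ i : ℂ) * (i - d)‖ := by gcongr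
      _ = _ := by ring
  · refine (norm_derivTransform_le hh H.h_lt_g hK hs).trans (le_of_eq ?_)
    rw [sub_eq_neg_add, Real.rpow_add hh]
    ring

/-- All exponents d - i are at least 1, so V(x) = O(x) at 0. With boundedness at ∞ this makes -1 <
Re z < 0 a strip of convergence, which is d-1 < Re s < d for z = s - d. -/
theorem isBigO_zero (H : IsTubeFunction V d κ h g lam) :
    (fun x => (V x : ℂ)) =O[𝓝[>] 0] fun x : ℝ => x ^ (-(-1) : ℝ) := by
  have h1 : (fun x : ℝ => ∑ i ∈ Finset.range d, κ i * x ^ (d - i)) =O[𝓝[>] 0] fun x : ℝ => x := by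
    refine Asymptotics.IsBigO.fun_sum fun i hi => ?_
    have hid : d - i = (d - i - 1) + 1 := by
      have := Finset.mem_range.1 hi
      omega
    have h2 : (fun x : ℝ => κ i * x ^ (d - i - 1)) =O[𝓝[>] 0] fun _ => (1 : ℝ) :=
      ((Continuous.tendsto (by fun_prop) 0).mono_left nhdsWithin_le_nhds).isBigO_one ℝ
    have h3 := h2.mul (Asymptotics.isBigO_refl (fun x : ℝ => x) (𝓝[>] 0))
    refine (h3.congr_left fun x => ?_).congr_right fun x => one_mul x
    conv_rhs => rw [hid, pow_succ]
    ring
  rw [← Asymptotics.isBigO_norm_left]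
  simp only [Complex.norm_real, neg_neg, Real.rpow_one, Asymptotics.isBigO_norm_left]
  refine h1.congr' ?_ EventuallyEq.rfl
  have h3 : ∀ᶠ x : ℝ in 𝓝[>] 0, x < h := mem_nhdsWithin_of_mem_nhds (Iio_mem_nhds H.h_pos)
  filter_upwards [h3, self_mem_nhdsWithin] with x hx hx'
  exact (H.poly x hx' hx).symm

theorem isBigO_atTop (H : IsTubeFunction V d κ h g lam) :
    (fun x => (V x : ℂ)) =O[atTop] fun x : ℝ => x ^ (-0 : ℝ) := by
  simp only [neg_zero, Real.rpow_zero]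
  refine (Asymptotics.isBigO_const_const ((-κ d : ℝ) : ℂ) one_ne_zero atTop).congr' ?_
    EventuallyEq.rfl
  filter_upwards [eventually_ge_atTop g] with x hx
  rw [H.eq_const x hx]

theorem mellinConvergent (H : IsTubeFunction V d κ h g lam) {z : ℂ} (h1 : -1 < z.re)
    (h2 : z.re < 0) : MellinConvergent (fun x => (V x : ℂ)) z := by
  refine mellinConvergent_of_isBigO_rpow ?_ H.isBigO_atTop h2 H.isBigO_zero h1
  refine ContinuousOn.locallyIntegrableOn (fun x hx => ?_) measurableSet_Ioi
  exact (Complex.continuous_ofReal.continuousAt.comp (H.continuousAt x hx)).continuousWithinAt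

/-- The integral is split at h and g. The powers on (0, h] are integrable because Re s > d-1 ≥ i,
the constant on (g, ∞) because Re s < d; the middle piece is `Lam`. -/
theorem mellin_eq_tubeTransform (H : IsTubeFunction V d κ h g lam) {s : ℂ}
    (h1 : (d : ℝ) - 1 < s.re) (h2 : s.re < d) :
    mellin (fun x => (V x : ℂ)) (s - d) = tubeTransform d κ h g lam s := by
  have hconv := H.mellinConvergent (z := s - d) (by simp; linarith) (by simp; linarith)
  have hh := H.h_pos
  have hhg := H.h_lt_g
  rw [MellinConvergent] at hconv
  have hsplit : Set.Ioi (0 : ℝ) = Set.Ioc 0 h ∪ (Set.Ioc h g ∪ Set.Ioi g) := by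
    rw [Set.Ioc_union_Ioi_eq_Ioi hhg.le, Set.Ioc_union_Ioi_eq_Ioi hh.le]
  have hd2 : Disjoint (Set.Ioc h g) (Set.Ioi g) :=
    Set.disjoint_left.2 fun x hx hx' => not_lt.2 hx.2 hx'
  have hd1 : Disjoint (Set.Ioc 0 h) (Set.Ioc h g ∪ Set.Ioi g) := by
    rw [Set.Ioc_union_Ioi_eq_Ioi hhg.le]
    exact Set.disjoint_left.2 fun x hx hx' => not_lt.2 hx.2 hx'
  have i1 := hconv.mono_set (hsplit ▸ Set.subset_union_left)
  have i23 := hconv.mono_set (hsplit ▸ Set.subset_union_right)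
  have i2 := i23.mono_set Set.subset_union_left
  have i3 := i23.mono_set Set.subset_union_right
  rw [mellin, hsplit, setIntegral_union hd1 (measurableSet_Ioc.union measurableSet_Ioi) i1 i23,
    setIntegral_union hd2 measurableSet_Ioi i2 i3, tubeTransform, add_assoc]
  have e1 : ∫ t in Set.Ioc 0 h, (t : ℂ) ^ (s - d - 1) • (V t : ℂ) =
      ∑ i ∈ Finset.range d, (h : ℂ) ^ (s - i) / (s - i) * (κ i : ℂ) := by
    have : ∫ t in Set.Ioc 0 h, (t : ℂ) ^ (s - d - 1) • (V t : ℂ) =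
        ∫ t in (0 : ℝ)..h, ∑ i ∈ Finset.range d, (t : ℂ) ^ (s - i - 1) * (κ i : ℂ) := by
      rw [intervalIntegral.integral_of_le hh.le]
      rw [integral_Ioc_eq_integral_Ioo, integral_Ioc_eq_integral_Ioo]
      refine setIntegral_congr_fun measurableSet_Ioo fun t ht => ?_
      have ht0 : (t : ℂ) ≠ 0 := by exact_mod_cast ht.1.ne'
      simp only [H.poly t ht.1 ht.2]
      push_cast
      rw [smul_eq_mul, Finset.mul_sum]
      refine Finset.sum_congr rfl fun i hi => ?_
      rw [mul_comm (κ i : ℂ), ← mul_assoc, ← Complex.cpow_natCast, ← Complex.cpow_add _ _ ht0,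
        Nat.cast_sub (Finset.mem_range.1 hi).le]
      congr 2
      ring
    have hre : ∀ i ∈ Finset.range d, -1 < (s - i - 1).re := by
      intro i hi
      have h3 : (i : ℝ) + 1 ≤ d := by exact_mod_cast Finset.mem_range.1 hi
      simp only [Complex.sub_re, Complex.natCast_re, Complex.one_re]
      linarith
    rw [this, intervalIntegral.integral_finsetSum]
    · refine Finset.sum_congr rfl fun i hi => ?_
      have hre' := hre i hi
      rw [intervalIntegral.integral_mul_const, integral_cpow (Or.inl hre'), sub_add_cancel,
        Complex.ofReal_zero, Complex.zero_cpow, sub_zero]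
      intro h0
      rw [h0] at hre'
      simp at hre'
    · exact fun i hi => (intervalIntegral.intervalIntegrable_cpow' (hre i hi)).mul_const _
  have e2 : ∫ t in Set.Ioc h g, (t : ℂ) ^ (s - d - 1) • (V t : ℂ) = Lam d h g lam s := by
    rw [Lam, intervalIntegral.integral_of_le hhg.le]
    refine setIntegral_congr_fun measurableSet_Ioc fun t ht => ?_
    simp only [H.eq_lam t ht.1.le ht.2, smul_eq_mul]
  have e3 : ∫ t in Set.Ioi g, (t : ℂ) ^ (s - d - 1) • (V t : ℂ) =
      (g : ℂ) ^ (s - d) / (s - d) * (κ d : ℂ) := by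
    have : ∫ t in Set.Ioi g, (t : ℂ) ^ (s - d - 1) • (V t : ℂ) =
        ∫ t in Set.Ioi g, (t : ℂ) ^ (s - d - 1) * (-κ d : ℂ) := by
      refine setIntegral_congr_fun measurableSet_Ioi fun t ht => ?_
      have ht' : g < t := ht
      simp only [H.eq_const t ht'.le, smul_eq_mul]
      push_cast
      rfl
    rw [this, integral_mul_const, integral_Ioi_cpow_of_lt _ (hh.trans hhg), sub_add_cancel]
    · ring
    · simp only [Complex.sub_re, Complex.natCast_re, Complex.one_re]
      linarith
  rw [e1, e2, e3, add_comm (Lam d h g lam s)]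

theorem continuous_tubeTransform_line (H : IsTubeFunction V d κ h g lam) {c : ℝ}
    (h1 : (d : ℝ) - 1 < c) (h2 : c < d) :
    Continuous fun t : ℝ => tubeTransform d κ h g lam (c + t * Complex.I) := by
  have hne : ∀ i ≤ d, ∀ t : ℝ, (c + t * Complex.I - (i : ℕ) : ℂ) ≠ 0 := by
    intro i hi t h0
    have := congrArg Complex.re h0
    simp at this
    have hci : c = i := by linarith
    rw [hci] at h1 h2
    have h3 : i < d := by exact_mod_cast h2
    have h4 : (i : ℝ) + 1 ≤ d := by exact_mod_cast h3
    linarith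
  have hpow : ∀ x : ℝ, 0 < x → ∀ i : ℕ,
      Continuous fun t : ℝ => (x : ℂ) ^ (c + t * Complex.I - (i : ℕ) : ℂ) := by
    intro x hx i
    exact Continuous.const_cpow (by fun_prop) (Or.inl (by exact_mod_cast hx.ne'))
  unfold tubeTransform
  refine Continuous.add (Continuous.add ?_ ?_) ?_
  · refine continuous_finsetSum _ fun i hi => ?_
    exact (Continuous.div (hpow h H.h_pos i) (by fun_prop)
      (hne i (Finset.mem_range.1 hi).le)).mul continuous_const
  · exact (Continuous.div (hpow g (H.h_pos.trans H.h_lt_g) d) (by fun_prop)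
      (hne d le_rfl)).mul continuous_const
  · exact (differentiable_Lam H.h_pos H.h_lt_g H.piecewise.1).continuous.comp (by fun_prop)

/-- After `tubeTransform_eq` each polynomial term has two linear factors in the denominator. What
remains, `derivTransform` times 1/(s - d), is a product of two square integrable functions. In both
cases xy ≤ x² + y² suffices. The line avoids all integers because d-1 < c < d. -/
theorem integrable_tubeTransform_line (H : IsTubeFunction V d κ h g lam) {c : ℝ}
    (h1 : (d : ℝ) - 1 < c) (h2 : c < d) :
    Integrable fun t : ℝ => tubeTransform d κ h g lam (c + t * Complex.I) := by
  have hci : ∀ i ≤ d, c - (i : ℕ) ≠ 0 := by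
    intro i hi h0
    rw [sub_eq_zero.1 h0] at h1 h2
    have h3 : i < d := by exact_mod_cast h2
    have h4 : (i : ℝ) + 1 ≤ d := by exact_mod_cast h3
    linarith
  have hnormsq : ∀ (i : ℕ) (t : ℝ), ‖(c + t * Complex.I - i : ℂ)‖ ^ 2 = (c - i) ^ 2 + t ^ 2 := by
    intro i t
    rw [← Complex.normSq_eq_norm_sq, Complex.normSq_apply]
    simp
    ring
  have hint : ∀ i ≤ d, Integrable fun t : ℝ => (‖(c + t * Complex.I - (i : ℕ) : ℂ)‖ ^ 2)⁻¹ := by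
    intro i hi
    simp_rw [hnormsq]
    exact integrable_inv_sq_add_sq (hci i hi)
  obtain ⟨-, K, hK⟩ := H.piecewise.exists_finite_differentiableAt
  have hN : Integrable fun t : ℝ => ‖derivTransform d h g lam (c + t * Complex.I)‖ ^ 2 := by
    -- The abscissa is c - d + 1 because the kernel u^{s-d} is u^{z-1} with z = s - d + 1.
    have := integrable_sq_norm_mellin_indicator_Ioc (h := h) (g := g) (K := K) H.h_pos
      (φ := fun u => ((deriv lam u : ℝ) : ℂ)) (Complex.measurable_ofReal.comp (measurable_deriv lam))
      (fun u hu => by simpa using hK u (Set.Ioc_subset_Icc_self hu)) (c - d + 1)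
    refine this.congr (Eventually.of_forall fun t => ?_)
    simp only [mellin_indicator_Ioc H.h_pos H.h_lt_g.le, derivTransform]
    congr 3
    ext u
    congr 2
    push_cast
    ring
  have hbound : Integrable fun t : ℝ =>
      (∑ i ∈ Finset.range d, h ^ (c - i) * ‖(κ i : ℂ) * (i - d)‖ *
        ((‖(c + t * Complex.I - i : ℂ)‖ ^ 2)⁻¹ + (‖(c + t * Complex.I - d : ℂ)‖ ^ 2)⁻¹)) +
      (‖derivTransform d h g lam (c + t * Complex.I)‖ ^ 2 +
        (‖(c + t * Complex.I - d : ℂ)‖ ^ 2)⁻¹) := by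
    refine Integrable.add (integrable_finsetSum _ fun i hi => ?_) (hN.add (hint d le_rfl))
    exact ((hint i (Finset.mem_range.1 hi).le).add (hint d le_rfl)).const_mul _
  refine hbound.mono' (H.continuous_tubeTransform_line h1 h2).aestronglyMeasurable
    (Eventually.of_forall fun t => ?_)
  have hxy : ∀ x y : ℝ, 0 ≤ x → 0 ≤ y → x * y ≤ x ^ 2 + y ^ 2 := fun x y hx hy => by
    nlinarith [sq_nonneg (x - y), mul_nonneg hx hy]
  rw [H.tubeTransform_eq (s := c + t * Complex.I), norm_div, div_eq_mul_inv]
  · refine (mul_le_mul_of_nonneg_right (norm_sub_le _ _) (by positivity)).trans ?_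
    rw [add_mul]
    refine add_le_add ((mul_le_mul_of_nonneg_right (norm_sum_le _ _) (by positivity)).trans ?_) ?_
    · rw [Finset.sum_mul]
      refine Finset.sum_le_sum fun i hi => ?_
      rw [norm_mul, norm_div, Complex.norm_cpow_eq_rpow_re_of_pos H.h_pos]
      have hre : (c + t * Complex.I - i : ℂ).re = c - i := by simp
      rw [hre, ← inv_pow, ← inv_pow]
      calc h ^ (c - i) / ‖(c + t * Complex.I - i : ℂ)‖ * ‖(κ i : ℂ) * (i - d)‖ *
            ‖(c + t * Complex.I - d : ℂ)‖⁻¹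
          = h ^ (c - i) * ‖(κ i : ℂ) * (i - d)‖ *
            (‖(c + t * Complex.I - i : ℂ)‖⁻¹ * ‖(c + t * Complex.I - d : ℂ)‖⁻¹) := by ring
        _ ≤ _ := mul_le_mul_of_nonneg_left (hxy _ _ (by positivity) (by positivity))
            (mul_nonneg (Real.rpow_nonneg H.h_pos.le _) (norm_nonneg _))
    · rw [← inv_pow]
      exact hxy _ _ (norm_nonneg _) (by positivity)
  · intro i hi h0
    have := congrArg Complex.re h0
    simp at this
    exact hci i hi (sub_eq_zero.2 this)

/-- Mellin inversion for the tube function. -/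
theorem eq_integral_tubeTransform (H : IsTubeFunction V d κ h g lam) {c : ℝ}
    (h1 : (d : ℝ) - 1 < c) (h2 : c < d) {x : ℝ} (hx : 0 < x) :
    (V x : ℂ) = (1 / (2 * Real.pi) : ℝ) * ∫ t : ℝ, (x : ℂ) ^ (d - (c + t * Complex.I)) *
      tubeTransform d κ h g lam (c + t * Complex.I) := by
  have hmel : ∀ t : ℝ, mellin (fun x => (V x : ℂ)) ((c - d : ℝ) + t * Complex.I) =
      tubeTransform d κ h g lam (c + t * Complex.I) := by
    intro t
    rw [← H.mellin_eq_tubeTransform (by simpa using h1) (by simpa using h2)]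
    congr 1
    push_cast
    ring
  have hinv := mellinInv_mellin_eq (c - d) (fun x => (V x : ℂ)) hx
    (H.mellinConvergent (by simp; linarith) (by simp; linarith)) ?_
    (Complex.continuous_ofReal.continuousAt.comp (H.continuousAt x hx))
  · rw [← hinv, mellinInv, Complex.real_smul]
    congr 1
    refine integral_congr_ae (Eventually.of_forall fun t => ?_)
    simp only [hmel t, smul_eq_mul]
    congr 2
    push_cast
    ring
  · rw [Complex.VerticalIntegrable]
    simp only [hmel]
    exact H.integrable_tubeTransform_line h1 h2

end IsTubeFunction

/-! ### Polar parts and residues -/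

/-- Each induction step splits off A(ω) by A(z) = A(ω) + (z - ω) `dslope A ω z`. The identity holds
on the whole punctured plane, not only near ω, which allows a polar part to be subtracted globally
in the residue theorem. -/
theorem AnalyticAt.exists_mul_inv_pow_eq_polar {A : ℂ → ℂ} {ω : ℂ} (hA : AnalyticAt ℂ A ω)
    (n : ℕ) : ∃ (a : ℕ → ℂ) (B : ℂ → ℂ), AnalyticAt ℂ B ω ∧ ∀ z ≠ ω,
      A z * (z - ω)⁻¹ ^ n = ∑ k ∈ Finset.range n, a k * (z - ω)⁻¹ ^ (k + 1) + B z := by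
  induction n generalizing A with
  | zero => exact ⟨0, A, hA, by simp⟩
  | succ n ih =>
    have hA1 : AnalyticAt ℂ (dslope A ω) ω := by
      obtain ⟨p, hp⟩ := hA
      exact ⟨_, hp.has_fpower_series_dslope_fslope⟩
    obtain ⟨a, B, hB, hz⟩ := ih hA1
    refine ⟨fun k => if k = n then A ω else a k, B, hB, fun z hzω => ?_⟩
    have h0 : z - ω ≠ 0 := sub_ne_zero.2 hzω
    have hsum : ∑ k ∈ Finset.range n, (if k = n then A ω else a k) * (z - ω)⁻¹ ^ (k + 1) =
        ∑ k ∈ Finset.range n, a k * (z - ω)⁻¹ ^ (k + 1) :=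
      Finset.sum_congr rfl fun k hk => by rw [if_neg (Finset.mem_range.1 hk).ne]
    have hA2 : A z = A ω + (z - ω) * dslope A ω z := by
      have := sub_smul_dslope A ω z
      rw [smul_eq_mul] at this
      rw [this]
      ring
    simp only [Finset.sum_range_succ, hsum, if_true]
    rw [add_right_comm, ← hz z hzω, hA2, pow_succ]
    field_simp
    ring

theorem MeromorphicAt.exists_polar {f : ℂ → ℂ} {ω : ℂ} (hf : MeromorphicAt f ω) :
    ∃ (n : ℕ) (a : ℕ → ℂ) (B : ℂ → ℂ), AnalyticAt ℂ B ω ∧ ∀ z ≠ ω,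
      f z = ∑ k ∈ Finset.range (n + 1), a k * (z - ω)⁻¹ ^ (k + 1) + B z := by
  obtain ⟨n, hn⟩ := hf
  -- The extra factor z - ω makes the polar sum nonempty even for n = 0, so that the coefficient `a
  -- 0` always exists.
  have hn' : AnalyticAt ℂ (fun z => (z - ω) * ((z - ω) ^ n • f z)) ω :=
    (analyticAt_id.sub analyticAt_const).mul hn
  obtain ⟨a, B, hB, hz⟩ := hn'.exists_mul_inv_pow_eq_polar (n + 1)
  refine ⟨n, a, B, hB, fun z hzω => ?_⟩
  have h0 : z - ω ≠ 0 := sub_ne_zero.2 hzω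
  rw [← hz z hzω, smul_eq_mul, inv_pow, pow_succ]
  field_simp

/-- On every small circle B contributes 0 by Cauchy, and so do the powers below -1; the normalised
integral is thus eventually constant as ρ → 0, and the limit is `a 0`. -/
theorem residue_eq_of_polar {f B : ℂ → ℂ} {ω : ℂ} {n : ℕ} {a : ℕ → ℂ} (hB : AnalyticAt ℂ B ω)
    (hf : ∀ᶠ z in 𝓝[≠] ω,
      f z = ∑ k ∈ Finset.range (n + 1), a k * (z - ω)⁻¹ ^ (k + 1) + B z) :
    residue f ω = a 0 := by
  have hev := hB.eventually_analyticAt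
  rw [eventually_nhdsWithin_iff] at hf
  obtain ⟨δ, hδ, hball⟩ := Metric.eventually_nhds_iff_ball.1 (hev.and hf)
  refine Tendsto.limUnder_eq (tendsto_const_nhds.congr' ?_)
  have hsmall : ∀ᶠ ρ : ℝ in 𝓝[>] 0, ρ < δ := mem_nhdsWithin_of_mem_nhds (Iio_mem_nhds hδ)
  filter_upwards [hsmall, self_mem_nhdsWithin] with ρ hρδ hρ
  have hρ0 : 0 < ρ := hρ
  have hne : ∀ z ∈ Metric.sphere ω ρ, z - ω ≠ 0 := fun z hz =>
    sub_ne_zero.2 (Metric.ne_of_mem_sphere hz hρ0.ne')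
  have hsph : ∀ z ∈ Metric.sphere ω ρ, z ∈ Metric.ball ω δ := fun z hz =>
    Metric.mem_ball.2 ((Metric.mem_sphere.1 hz).trans_lt hρδ)
  have hterm : ∀ k : ℕ, CircleIntegrable (fun z => a k * (z - ω)⁻¹ ^ (k + 1)) ω ρ := by
    intro k
    refine ContinuousOn.circleIntegrable hρ0.le ?_
    exact continuousOn_const.mul (((continuousOn_id.sub continuousOn_const).inv₀ hne).pow _)
  have hBc : CircleIntegrable B ω ρ := by
    refine ContinuousOn.circleIntegrable hρ0.le fun z hz => ?_
    exact (hball z (hsph z hz)).1.continuousAt.continuousWithinAt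
  have hB0 : ∮ z in C(ω, ρ), B z = 0 := by
    refine Complex.circleIntegral_eq_zero_of_differentiable_on_off_countable hρ0.le
      (s := ∅) Set.countable_empty (fun z hz => ?_) (fun z hz => ?_)
    · exact (hball z (Metric.closedBall_subset_ball hρδ hz)).1.continuousAt.continuousWithinAt
    · exact (hball z (Metric.ball_subset_ball hρδ.le hz.1)).1.differentiableAt
  have hsum : CircleIntegrable
      (fun z => ∑ k ∈ Finset.range (n + 1), a k * (z - ω)⁻¹ ^ (k + 1)) ω ρ := by
    refine ContinuousOn.circleIntegrable hρ0.le ?_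
    refine continuousOn_finsetSum _ fun k _ => ?_
    exact continuousOn_const.mul (((continuousOn_id.sub continuousOn_const).inv₀ hne).pow _)
  have hcongr : ∮ z in C(ω, ρ), f z =
      ∮ z in C(ω, ρ), (∑ k ∈ Finset.range (n + 1), a k * (z - ω)⁻¹ ^ (k + 1) + B z) := by
    refine circleIntegral.integral_congr hρ0.le fun z hz => ?_
    exact (hball z (hsph z hz)).2 (Metric.ne_of_mem_sphere hz hρ0.ne')
  have hone : ∀ k : ℕ, ∮ z in C(ω, ρ), a k * (z - ω)⁻¹ ^ (k + 1) =
      if k = 0 then a 0 * (2 * Real.pi * Complex.I) else 0 := by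
    intro k
    rw [circleIntegral.integral_const_mul]
    split_ifs with hk
    · subst hk
      simp only [zero_add, pow_one]
      rw [circleIntegral.integral_sub_center_inv ω hρ0.ne']
    · have : ∀ z : ℂ, (z - ω)⁻¹ ^ (k + 1) = (z - ω) ^ (-((k : ℤ) + 1)) := by
        intro z
        rw [zpow_neg, inv_pow]
        norm_cast
      simp_rw [this]
      rw [circleIntegral.integral_sub_zpow_of_ne (by omega), mul_zero]
  rw [hcongr, circleIntegral.integral_add hsum hBc, hB0, add_zero]
  have hfs : ∮ z in C(ω, ρ), ∑ k ∈ Finset.range (n + 1), a k * (z - ω)⁻¹ ^ (k + 1) =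
      ∑ k ∈ Finset.range (n + 1), ∮ z in C(ω, ρ), a k * (z - ω)⁻¹ ^ (k + 1) := by
    simp only [circleIntegral, Finset.smul_sum]
    exact intervalIntegral.integral_finsetSum fun k _ => (hterm k).out
  rw [hfs, Finset.sum_congr rfl fun k _ => hone k, Finset.sum_ite_eq' (Finset.range (n + 1)) 0,
    if_pos (by simp)]
  field_simp

/-! ### The residue theorem for rectangles -/

/-- The boundary of the rectangle `[a, b] × [m, M]`. -/
def rectBoundary (a b m M : ℝ) : Set ℂ :=
  (Set.Icc a b ×ℂ Set.Icc m M) \ (Set.Ioo a b ×ℂ Set.Ioo m M)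

/-- The counterclockwise integral over the boundary of the rectangle `[a, b] × [m, M]`. -/
noncomputable def rectIntegral (f : ℂ → ℂ) (a b m M : ℝ) : ℂ :=
  (∫ x in a..b, f (x + m * Complex.I)) - (∫ x in a..b, f (x + M * Complex.I)) +
    Complex.I * (∫ y in m..M, f (b + y * Complex.I)) -
    Complex.I * ∫ y in m..M, f (a + y * Complex.I)

section Rect

variable {a b m M : ℝ}

theorem horizontal_mem_rectBoundary (hm : m ≤ M) {x y : ℝ} (hx : x ∈ Set.uIcc a b) (hab : a ≤ b)
    (hy : y = m ∨ y = M) : (x + y * Complex.I : ℂ) ∈ rectBoundary a b m M := by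
  rw [Set.uIcc_of_le hab] at hx
  refine ⟨Complex.mem_reProdIm.2 ⟨by simpa using hx, ?_⟩, fun h => ?_⟩
  · rcases hy with rfl | rfl <;> simp [hm]
  · have := (Complex.mem_reProdIm.1 h).2
    rcases hy with rfl | rfl <;> simp at this

theorem vertical_mem_rectBoundary (hm : m ≤ M) {x y : ℝ} (hy : y ∈ Set.uIcc m M) (hab : a ≤ b)
    (hx : x = a ∨ x = b) : (x + y * Complex.I : ℂ) ∈ rectBoundary a b m M := by
  rw [Set.uIcc_of_le hm] at hy
  refine ⟨Complex.mem_reProdIm.2 ⟨?_, by simpa using hy⟩, fun h => ?_⟩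
  · rcases hx with rfl | rfl <;> simp [hab]
  · have := (Complex.mem_reProdIm.1 h).1
    rcases hx with rfl | rfl <;> simp at this

theorem continuousOn_horizontal {f : ℂ → ℂ} (hf : ContinuousOn f (rectBoundary a b m M))
    (hab : a ≤ b) (hm : m ≤ M) {y : ℝ} (hy : y = m ∨ y = M) :
    ContinuousOn (fun x : ℝ => f (x + y * Complex.I)) (Set.uIcc a b) :=
  hf.comp (by fun_prop) fun _ hx => horizontal_mem_rectBoundary hm hx hab hy

theorem continuousOn_vertical {f : ℂ → ℂ} (hf : ContinuousOn f (rectBoundary a b m M))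
    (hab : a ≤ b) (hm : m ≤ M) {x : ℝ} (hx : x = a ∨ x = b) :
    ContinuousOn (fun y : ℝ => f (x + y * Complex.I)) (Set.uIcc m M) :=
  hf.comp (by fun_prop) fun _ hy => vertical_mem_rectBoundary hm hy hab hx

theorem rectIntegral_add {f₁ f₂ : ℂ → ℂ} (hab : a ≤ b) (hm : m ≤ M)
    (h₁ : ContinuousOn f₁ (rectBoundary a b m M)) (h₂ : ContinuousOn f₂ (rectBoundary a b m M)) :
    rectIntegral (fun z => f₁ z + f₂ z) a b m M =
      rectIntegral f₁ a b m M + rectIntegral f₂ a b m M := by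
  unfold rectIntegral
  rw [intervalIntegral.integral_add
      (continuousOn_horizontal h₁ hab hm (Or.inl rfl)).intervalIntegrable
      (continuousOn_horizontal h₂ hab hm (Or.inl rfl)).intervalIntegrable,
    intervalIntegral.integral_add
      (continuousOn_horizontal h₁ hab hm (Or.inr rfl)).intervalIntegrable
      (continuousOn_horizontal h₂ hab hm (Or.inr rfl)).intervalIntegrable,
    intervalIntegral.integral_add
      (continuousOn_vertical h₁ hab hm (Or.inl rfl)).intervalIntegrable
      (continuousOn_vertical h₂ hab hm (Or.inl rfl)).intervalIntegrable,
    intervalIntegral.integral_add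
      (continuousOn_vertical h₁ hab hm (Or.inr rfl)).intervalIntegrable
      (continuousOn_vertical h₂ hab hm (Or.inr rfl)).intervalIntegrable]
  ring

theorem rectIntegral_congr {f₁ f₂ : ℂ → ℂ} (hab : a ≤ b) (hm : m ≤ M)
    (h : Set.EqOn f₁ f₂ (rectBoundary a b m M)) :
    rectIntegral f₁ a b m M = rectIntegral f₂ a b m M := by
  unfold rectIntegral
  rw [intervalIntegral.integral_congr fun x hx =>
      h (horizontal_mem_rectBoundary hm hx hab (Or.inl rfl)),
    intervalIntegral.integral_congr fun x hx =>
      h (horizontal_mem_rectBoundary hm hx hab (Or.inr rfl)),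
    intervalIntegral.integral_congr fun x hx =>
      h (vertical_mem_rectBoundary hm hx hab (Or.inl rfl)),
    intervalIntegral.integral_congr fun x hx =>
      h (vertical_mem_rectBoundary hm hx hab (Or.inr rfl))]

theorem rectIntegral_const_mul (c : ℂ) (f : ℂ → ℂ) :
    rectIntegral (fun z => c * f z) a b m M = c * rectIntegral f a b m M := by
  simp only [rectIntegral, intervalIntegral.integral_const_mul]
  ring

theorem rectIntegral_zero : rectIntegral (fun _ => 0) a b m M = 0 := by
  simp [rectIntegral]

theorem rectIntegral_sum {ι : Type*} (s : Finset ι) {f : ι → ℂ → ℂ} (hab : a ≤ b) (hm : m ≤ M)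
    (hf : ∀ i ∈ s, ContinuousOn (f i) (rectBoundary a b m M)) :
    rectIntegral (fun z => ∑ i ∈ s, f i z) a b m M = ∑ i ∈ s, rectIntegral (f i) a b m M := by
  classical
  induction s using Finset.induction_on with
  | empty => simp [rectIntegral_zero]
  | insert i s hi ih =>
    simp only [Finset.sum_insert hi]
    rw [rectIntegral_add hab hm (hf i (Finset.mem_insert_self i s))
      (continuousOn_finsetSum _ fun j hj => hf j (Finset.mem_insert_of_mem hj)),
      ih fun j hj => hf j (Finset.mem_insert_of_mem hj)]

theorem integral_horizontal_eq_sub {f P : ℂ → ℂ} {y : ℝ}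
    (hP : ∀ x ∈ Set.uIcc a b, HasDerivAt P (f (x + y * Complex.I)) (x + y * Complex.I))
    (hf : ContinuousOn (fun x : ℝ => f (x + y * Complex.I)) (Set.uIcc a b)) :
    ∫ x in a..b, f (x + y * Complex.I) = P (b + y * Complex.I) - P (a + y * Complex.I) := by
  refine intervalIntegral.integral_eq_sub_of_hasDerivAt
    (f := fun x : ℝ => P (x + y * Complex.I)) (fun x hx => ?_) hf.intervalIntegrable
  have h1 : HasDerivAt (fun x : ℂ => x + y * Complex.I) 1 (x : ℂ) :=
    (hasDerivAt_id _).add_const _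
  have h2 := (HasDerivAt.comp (x : ℂ) (hP x hx) h1).comp_ofReal
  simpa [Function.comp_def] using h2

theorem integral_vertical_eq_sub {f P : ℂ → ℂ} {x : ℝ}
    (hP : ∀ y ∈ Set.uIcc m M, HasDerivAt P (f (x + y * Complex.I)) (x + y * Complex.I))
    (hf : ContinuousOn (fun y : ℝ => f (x + y * Complex.I)) (Set.uIcc m M)) :
    Complex.I * ∫ y in m..M, f (x + y * Complex.I) =
      P (x + M * Complex.I) - P (x + m * Complex.I) := by
  rw [← intervalIntegral.integral_const_mul]
  refine intervalIntegral.integral_eq_sub_of_hasDerivAt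
    (f := fun y : ℝ => P (x + y * Complex.I)) (fun y hy => ?_)
    (continuousOn_const.mul hf).intervalIntegrable
  have h1 : HasDerivAt (fun y : ℂ => x + y * Complex.I) Complex.I (y : ℂ) := by
    simpa using ((hasDerivAt_id (y : ℂ)).mul_const Complex.I).const_add (x : ℂ)
  have h2 := (HasDerivAt.comp (y : ℂ) (hP y hy) h1).comp_ofReal
  simpa [Function.comp_def, mul_comm] using h2

theorem sub_ne_zero_of_mem_rectBoundary {ω z : ℂ} (hre : ω.re ∈ Set.Ioo a b)
    (him : ω.im ∈ Set.Ioo m M) (hz : z ∈ rectBoundary a b m M) : z - ω ≠ 0 := by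
  rw [sub_ne_zero]
  rintro rfl
  exact hz.2 (Complex.mem_reProdIm.2 ⟨hre, him⟩)

theorem continuousOn_inv_pow_rectBoundary {ω : ℂ} (hre : ω.re ∈ Set.Ioo a b)
    (him : ω.im ∈ Set.Ioo m M) (k : ℕ) :
    ContinuousOn (fun z => (z - ω)⁻¹ ^ k) (rectBoundary a b m M) :=
  ((continuousOn_id.sub continuousOn_const).inv₀
    fun _ hz => sub_ne_zero_of_mem_rectBoundary hre him hz).pow _

/-- The integrand has a single-valued primitive away from ω, so the four boundary increments
telescope. -/
theorem rectIntegral_inv_pow_eq_zero {ω : ℂ} (hre : ω.re ∈ Set.Ioo a b)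
    (him : ω.im ∈ Set.Ioo m M) (k : ℕ) :
    rectIntegral (fun z => (z - ω)⁻¹ ^ (k + 2)) a b m M = 0 := by
  have hab : a ≤ b := (hre.1.trans hre.2).le
  have hm : m ≤ M := (him.1.trans him.2).le
  have hc := continuousOn_inv_pow_rectBoundary hre him (k + 2)
  have hP : ∀ z ∈ rectBoundary a b m M,
      HasDerivAt (fun z => -((k : ℂ) + 1)⁻¹ * (z - ω)⁻¹ ^ (k + 1)) ((z - ω)⁻¹ ^ (k + 2)) z := by
    intro z hz
    have h0 := sub_ne_zero_of_mem_rectBoundary hre him hz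
    have hk : (k : ℂ) + 1 ≠ 0 := by exact_mod_cast Nat.succ_ne_zero k
    have h1 : HasDerivAt (fun z => (z - ω)⁻¹) (-1 / (z - ω) ^ 2) z :=
      ((hasDerivAt_id z).sub_const ω).fun_inv h0
    refine ((h1.pow (k + 1)).const_mul (-((k : ℂ) + 1)⁻¹)).congr_deriv ?_
    push_cast
    rw [inv_pow, inv_pow]
    field_simp
    ring
  unfold rectIntegral
  rw [integral_horizontal_eq_sub (f := fun z => (z - ω)⁻¹ ^ (k + 2)) (fun x hx => hP _ (horizontal_mem_rectBoundary hm hx hab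
      (Or.inl rfl))) (continuousOn_horizontal hc hab hm (Or.inl rfl)),
    integral_horizontal_eq_sub (f := fun z => (z - ω)⁻¹ ^ (k + 2)) (fun x hx => hP _ (horizontal_mem_rectBoundary hm hx hab
      (Or.inr rfl))) (continuousOn_horizontal hc hab hm (Or.inr rfl)),
    integral_vertical_eq_sub (f := fun z => (z - ω)⁻¹ ^ (k + 2)) (fun x hx => hP _ (vertical_mem_rectBoundary hm hx hab
      (Or.inl rfl))) (continuousOn_vertical hc hab hm (Or.inl rfl)),
    integral_vertical_eq_sub (f := fun z => (z - ω)⁻¹ ^ (k + 2)) (fun x hx => hP _ (vertical_mem_rectBoundary hm hx hab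
      (Or.inr rfl))) (continuousOn_vertical hc hab hm (Or.inr rfl))]
  ring

theorem log_sub_log_neg_of_im_pos {z : ℂ} (hz : 0 < z.im) :
    Complex.log z - Complex.log (-z) = Real.pi * Complex.I := by
  rw [Complex.log, Complex.log, norm_neg, Complex.arg_neg_eq_arg_sub_pi_of_im_pos hz]
  push_cast
  ring

theorem log_sub_log_neg_of_im_neg {z : ℂ} (hz : z.im < 0) :
    Complex.log z - Complex.log (-z) = -(Real.pi * Complex.I) := by
  rw [Complex.log, Complex.log, norm_neg, Complex.arg_neg_eq_arg_add_pi_of_im_neg hz]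
  push_cast
  ring

/-- The principal logarithm of z - ω is a primitive on three sides. The left side crosses its cut,
so log(-(z - ω)) is used there; the mismatches at the two left corners contribute πi each. -/
theorem rectIntegral_inv {ω : ℂ} (hre : ω.re ∈ Set.Ioo a b) (him : ω.im ∈ Set.Ioo m M) :
    rectIntegral (fun z => (z - ω)⁻¹) a b m M = 2 * Real.pi * Complex.I := by
  have hab : a ≤ b := (hre.1.trans hre.2).le
  have hm : m ≤ M := (him.1.trans him.2).le
  have hc : ContinuousOn (fun z => (z - ω)⁻¹) (rectBoundary a b m M) := by
    simpa using continuousOn_inv_pow_rectBoundary hre him 1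
  have hP1 : ∀ z : ℂ, z - ω ∈ Complex.slitPlane →
      HasDerivAt (fun z => Complex.log (z - ω)) ((z - ω)⁻¹) z := by
    intro z hz
    simpa using ((hasDerivAt_id z).sub_const ω).clog hz
  have hP2 : ∀ z : ℂ, -(z - ω) ∈ Complex.slitPlane →
      HasDerivAt (fun z => Complex.log (-(z - ω))) ((z - ω)⁻¹) z := by
    intro z hz
    have := ((hasDerivAt_id z).sub_const ω).fun_neg.clog hz
    refine this.congr_deriv ?_
    simp only [id]
    rw [div_neg, neg_div, neg_neg, one_div]
  unfold rectIntegral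
  rw [integral_horizontal_eq_sub (f := fun z => (z - ω)⁻¹) (fun x hx => hP1 _ (Or.inr ?_))
      (continuousOn_horizontal hc hab hm (Or.inl rfl)),
    integral_horizontal_eq_sub (f := fun z => (z - ω)⁻¹) (fun x hx => hP1 _ (Or.inr ?_))
      (continuousOn_horizontal hc hab hm (Or.inr rfl)),
    integral_vertical_eq_sub (f := fun z => (z - ω)⁻¹) (fun x hx => hP2 _ (Or.inl ?_))
      (continuousOn_vertical hc hab hm (Or.inl rfl)),
    integral_vertical_eq_sub (f := fun z => (z - ω)⁻¹) (fun x hx => hP1 _ (Or.inl ?_))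
      (continuousOn_vertical hc hab hm (Or.inr rfl))]
  · have e1 := log_sub_log_neg_of_im_pos (z := a + M * Complex.I - ω)
      (by simpa using him.2)
    have e2 := log_sub_log_neg_of_im_neg (z := a + m * Complex.I - ω)
      (by simpa using him.1)
    linear_combination e1 - e2
  · simpa using hre.2
  · simpa using hre.1
  · simpa [sub_eq_zero] using him.2.ne'
  · simpa [sub_eq_zero] using him.1.ne

theorem rectIntegral_eq_zero_of_differentiableAt {f : ℂ → ℂ} (hab : a ≤ b) (hm : m ≤ M)
    (hf : ∀ z ∈ Set.Icc a b ×ℂ Set.Icc m M, DifferentiableAt ℂ f z) :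
    rectIntegral f a b m M = 0 := by
  have := Complex.integral_boundary_rect_eq_zero_of_differentiableOn f (a + m * Complex.I)
    (b + M * Complex.I) ?_
  · simpa [rectIntegral] using this
  · intro z hz
    refine (hf z ?_).differentiableWithinAt
    simpa [Set.uIcc_of_le hab, Set.uIcc_of_le hm] using hz

/-- The residue theorem for rectangles. -/
theorem rectIntegral_eq_sum_residue {f : ℂ → ℂ} (hab : a ≤ b) (hm : m ≤ M) (S : Finset ℂ)
    (hS : ∀ ω ∈ S, ω ∈ Set.Ioo a b ×ℂ Set.Ioo m M)
    (hmer : ∀ ω ∈ S, MeromorphicAt f ω)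
    (hf : ∀ z ∈ Set.Icc a b ×ℂ Set.Icc m M, z ∉ S → DifferentiableAt ℂ f z) :
    rectIntegral f a b m M = 2 * Real.pi * Complex.I * ∑ ω ∈ S, residue f ω := by
  classical
  induction S using Finset.induction_on generalizing f with
  | empty =>
    rw [Finset.sum_empty, mul_zero]
    exact rectIntegral_eq_zero_of_differentiableAt hab hm fun z hz => hf z hz (by simp)
  | insert ω S hωS ih =>
    -- Induction over the singularities: `B` is f without its polar part at ω. It is analytic at ω
    -- whatever the value of f there, and has the same residues at the points of S.
    obtain ⟨n, c, B, hB, hpolar⟩ := (hmer ω (Finset.mem_insert_self ω S)).exists_polar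
    have hω := Complex.mem_reProdIm.1 (hS ω (Finset.mem_insert_self ω S))
    set P : ℂ → ℂ := fun z => ∑ k ∈ Finset.range (n + 1), c k * (z - ω)⁻¹ ^ (k + 1) with hP
    have hPan : ∀ z ≠ ω, AnalyticAt ℂ P z := by
      intro z hz
      refine Finset.analyticAt_fun_sum _ fun k _ => ?_
      exact analyticAt_const.mul (((analyticAt_id.sub analyticAt_const).inv
        (sub_ne_zero.2 hz)).pow _)
    -- `f` with its polar part at `ω` removed
    have hfB : ∀ z ≠ ω, f z = P z + B z := hpolar
    have hBz : ∀ z ≠ ω, B =ᶠ[𝓝 z] fun z => f z - P z := by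
      intro z hz
      filter_upwards [isOpen_ne.mem_nhds hz] with y hy
      rw [hfB y hy]
      ring
    have hres : ∀ ω' ∈ S, residue B ω' = residue f ω' := by
      intro ω' hω'
      have hne : ω' ≠ ω := fun h => hωS (h ▸ hω')
      obtain ⟨n', c', B', hB', hpolar'⟩ :=
        (hmer ω' (Finset.mem_insert_of_mem hω')).exists_polar
      rw [residue_eq_of_polar (f := f) hB' (by
          filter_upwards [self_mem_nhdsWithin] with z hz using hpolar' z hz),
        residue_eq_of_polar (f := B) (hB'.sub (hPan ω' hne))]
      filter_upwards [self_mem_nhdsWithin, nhdsWithin_le_nhds (hBz ω' hne)] with z hz hz'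
      rw [hz', hpolar' z hz]
      simp only [Pi.sub_apply]
      ring
    have hih := ih (f := B) (fun ω' hω' => hS ω' (Finset.mem_insert_of_mem hω')) ?_ ?_
    · have hbd : ∀ z ∈ rectBoundary a b m M, z ≠ ω := fun z hz =>
        sub_ne_zero.1 (sub_ne_zero_of_mem_rectBoundary hω.1 hω.2 hz)
      have hPint : rectIntegral P a b m M = 2 * Real.pi * Complex.I * c 0 := by
        rw [hP, rectIntegral_sum (f := fun k z => c k * (z - ω)⁻¹ ^ (k + 1)) _ hab hm
          fun k _ => continuousOn_const.mul
            (continuousOn_inv_pow_rectBoundary hω.1 hω.2 (k + 1)), Finset.sum_range_succ',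
          Finset.sum_eq_zero fun k _ => by
            rw [rectIntegral_const_mul, rectIntegral_inv_pow_eq_zero hω.1 hω.2, mul_zero]]
        simp only [zero_add, pow_one]
        rw [rectIntegral_const_mul, rectIntegral_inv hω.1 hω.2]
        ring
      have hBc : ContinuousOn B (rectBoundary a b m M) := by
        intro z hz
        have hzS : z ∉ insert ω S := fun h => hz.2 (hS z h)
        exact (((hf z hz.1 hzS).sub (hPan z (hbd z hz)).differentiableAt).congr_of_eventuallyEq
          (hBz z (hbd z hz))).continuousAt.continuousWithinAt
      rw [rectIntegral_congr hab hm fun z hz => hfB z (hbd z hz), rectIntegral_add hab hm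
        (fun z hz => (hPan z (hbd z hz)).continuousAt.continuousWithinAt) hBc, hPint, hih,
        Finset.sum_insert hωS, Finset.sum_congr rfl hres,
        residue_eq_of_polar (f := f) hB (by
          filter_upwards [self_mem_nhdsWithin] with z hz using hpolar z hz)]
      ring
    · intro ω' hω'
      have hne : ω' ≠ ω := fun h => hωS (h ▸ hω')
      exact ((hmer ω' (Finset.mem_insert_of_mem hω')).sub (hPan ω' hne).meromorphicAt).congr
        ((hBz ω' hne).symm.filter_mono nhdsWithin_le_nhds)
    · intro z hz hzS
      rcases eq_or_ne z ω with rfl | hne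
      · exact hB.differentiableAt
      · exact ((hf z hz (by simp [hne, hzS])).sub (hPan z hne).differentiableAt).congr_of_eventuallyEq
          (hBz z hne)

end Rect

/-! ### The denominator of the scaling zeta function -/

/-- The denominator `1 - ∑_j r_j^s` of the scaling zeta function. -/
noncomputable def scalingDenom {J : ℕ} (r : Fin J → ℝ) (s : ℂ) : ℂ :=
  1 - ∑ j, (r j : ℂ) ^ s

/-- Infinitely many zeros in a compact set would accumulate, and the identity theorem would force f
= 0. -/
theorem finite_zeros_of_isCompact {f : ℂ → ℂ} (hf : Differentiable ℂ f) {z₀ : ℂ} (hz₀ : f z₀ ≠ 0)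
    {K : Set ℂ} (hK : IsCompact K) : {z ∈ K | f z = 0}.Finite := by
  by_contra hinf
  obtain ⟨z, -, hz⟩ := Set.Infinite.exists_accPt_of_subset_isCompact hinf hK fun z hz => hz.1
  have hfreq : ∃ᶠ w in 𝓝[≠] z, f w = 0 :=
    (accPt_iff_frequently_nhdsNE.1 hz).mono fun w hw => hw.2
  have han : AnalyticOnNhd ℂ f Set.univ := fun w _ => hf.analyticAt w
  exact hz₀ (han.eqOn_zero_of_preconnected_of_frequently_eq_zero isPreconnected_univ
    (Set.mem_univ z) hfreq (Set.mem_univ z₀))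

/-- The coefficients θ are there for the limits of vertical translates of the denominator, which
have this form with ‖θ j‖ ≤ 1. -/
theorem differentiable_one_sub_sum_mul_cpow {J : ℕ} {r : Fin J → ℝ} (hr : ∀ j, 0 < r j)
    (θ : Fin J → ℂ) : Differentiable ℂ fun s : ℂ => 1 - ∑ j, θ j * (r j : ℂ) ^ s := by
  refine (differentiable_const _).sub (Differentiable.fun_sum fun j _ => ?_)
  exact (differentiable_id.const_cpow (Or.inl (by exact_mod_cast (hr j).ne'))).const_mul _

section ScalingDenom

variable {J : ℕ} {r : Fin J → ℝ}

theorem differentiable_scalingDenom (hr : ∀ j, 0 < r j) : Differentiable ℂ (scalingDenom r) := by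
  have := differentiable_one_sub_sum_mul_cpow hr 1
  simp only [Pi.one_apply, one_mul] at this
  exact this

theorem le_norm_one_sub_sum_mul_cpow (hr : ∀ j, 0 < r j) (hr1 : ∀ j, r j < 1) {θ : Fin J → ℂ}
    (hθ : ∀ j, ‖θ j‖ ≤ 1) {c : ℝ} {s : ℂ} (hs : c ≤ s.re) :
    1 - ∑ j, r j ^ c ≤ ‖1 - ∑ j, θ j * (r j : ℂ) ^ s‖ := by
  have h1 : ‖∑ j, θ j * (r j : ℂ) ^ s‖ ≤ ∑ j, r j ^ c := by
    refine (norm_sum_le _ _).trans (Finset.sum_le_sum fun j _ => ?_)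
    rw [norm_mul, Complex.norm_cpow_eq_rpow_re_of_pos (hr j)]
    calc ‖θ j‖ * r j ^ s.re ≤ 1 * r j ^ c := mul_le_mul (hθ j)
          (Real.rpow_le_rpow_of_exponent_ge (hr j) (hr1 j).le hs)
          (Real.rpow_nonneg (hr j).le _) zero_le_one
      _ = r j ^ c := one_mul _
  have h2 := norm_sub_norm_le (1 : ℂ) (∑ j, θ j * (r j : ℂ) ^ s)
  rw [norm_one] at h2
  linarith

theorem le_norm_scalingDenom (hr : ∀ j, 0 < r j) (hr1 : ∀ j, r j < 1) {c : ℝ} {s : ℂ}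
    (hs : c ≤ s.re) : 1 - ∑ j, r j ^ c ≤ ‖scalingDenom r s‖ := by
  simpa [scalingDenom] using le_norm_one_sub_sum_mul_cpow hr hr1 (θ := 1) (by simp) hs

theorem sum_rpow_lt_one (hr : ∀ j, 0 < r j) (hr1 : ∀ j, r j < 1) {D c : ℝ}
    (hD : ∑ j, r j ^ D = 1) (hc : D < c) : ∑ j, r j ^ c < 1 := by
  rw [← hD]
  refine Finset.sum_lt_sum_of_nonempty ?_ fun j _ =>
    Real.rpow_lt_rpow_of_exponent_gt (hr j) (hr1 j) hc
  by_contra h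
  rw [Finset.not_nonempty_iff_eq_empty] at h
  simp [h] at hD

theorem re_le_of_scalingDenom_eq_zero (hr : ∀ j, 0 < r j) (hr1 : ∀ j, r j < 1) {D : ℝ}
    (hD : ∑ j, r j ^ D = 1) {s : ℂ} (hs : scalingDenom r s = 0) : s.re ≤ D := by
  by_contra h
  have h1 := le_norm_scalingDenom hr hr1 (le_refl s.re)
  have h2 := sum_rpow_lt_one hr hr1 hD (not_le.1 h)
  rw [hs, norm_zero] at h1
  linarith

/-- Far to the left, the term with the smallest ratio dominates. -/
theorem exists_one_le_norm_scalingDenom [Nonempty (Fin J)] (hr : ∀ j, 0 < r j)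
    (hr1 : ∀ j, r j < 1) :
    ∃ A : ℝ, 1 ≤ A ∧ ∀ s : ℂ, s.re ≤ -A → 1 ≤ ‖scalingDenom r s‖ := by
  classical
  obtain ⟨j₀, hj₀⟩ := Finite.exists_min r
  -- All indices attaining the minimal ratio are grouped: their terms coincide and cannot cancel.
  set I := Finset.univ.filter fun j => r j = r j₀ with hI
  have hlim1 : Tendsto (fun σ : ℝ => ∑ j ∈ Iᶜ, (r j / r j₀) ^ σ) atBot (𝓝 0) := by
    rw [← Finset.sum_const_zero (s := Iᶜ)]
    refine tendsto_finsetSum _ fun j hj => ?_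
    refine tendsto_rpow_atBot_of_base_gt_one _ ?_
    rw [one_lt_div (hr j₀)]
    have : r j ≠ r j₀ := by simpa [hI] using hj
    exact lt_of_le_of_ne (hj₀ j) this.symm
  have hlim2 : Tendsto (fun σ : ℝ => r j₀ ^ σ) atBot atTop :=
    tendsto_rpow_atBot_of_base_lt_one _ (hr j₀) (hr1 j₀)
  -- With x = r_{j₀}^{Re s} ≥ 4, the dominant terms are at least x and the others at most x/2, so
  -- the denominator is at least x - x/2 - 1 ≥ 1.
  have hev := (hlim1.eventually (gt_mem_nhds (show (0 : ℝ) < 1 / 2 by norm_num))).and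
    (hlim2.eventually_ge_atTop 4)
  obtain ⟨B, hB⟩ := eventually_atBot.1 hev
  refine ⟨max 1 (-B), le_max_left _ _, fun s hs => ?_⟩
  obtain ⟨h1, h2⟩ := hB s.re (by have := le_max_right 1 (-B); linarith)
  have e1 : ∑ j ∈ I, (r j : ℂ) ^ s = I.card * (r j₀ : ℂ) ^ s := by
    rw [Finset.sum_congr rfl fun j hj => by
      rw [show r j = r j₀ by simpa [hI] using hj], Finset.sum_const, nsmul_eq_mul]
  have hcard : (1 : ℝ) ≤ I.card := by
    have : 0 < I.card := Finset.card_pos.2 ⟨j₀, by simp [hI]⟩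
    exact_mod_cast this
  have n1 : r j₀ ^ s.re ≤ ‖∑ j ∈ I, (r j : ℂ) ^ s‖ := by
    rw [e1, norm_mul, Complex.norm_cpow_eq_rpow_re_of_pos (hr j₀), Complex.norm_natCast]
    exact le_mul_of_one_le_left (Real.rpow_nonneg (hr j₀).le _) hcard
  have n2 : ‖∑ j ∈ Iᶜ, (r j : ℂ) ^ s‖ ≤ r j₀ ^ s.re * (1 / 2) := by
    refine (norm_sum_le _ _).trans ?_
    refine le_trans (le_of_eq ?_)
      (mul_le_mul_of_nonneg_left h1.le (Real.rpow_nonneg (hr j₀).le _))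
    rw [Finset.mul_sum]
    refine Finset.sum_congr rfl fun j _ => ?_
    rw [Complex.norm_cpow_eq_rpow_re_of_pos (hr j), Real.div_rpow (hr j).le (hr j₀).le,
      mul_div_cancel₀ _ (Real.rpow_pos_of_pos (hr j₀) _).ne']
  have e2 : scalingDenom r s =
      1 - (∑ j ∈ I, (r j : ℂ) ^ s + ∑ j ∈ Iᶜ, (r j : ℂ) ^ s) := by
    rw [scalingDenom, Finset.sum_add_sum_compl]
  have n3 : ‖∑ j ∈ I, (r j : ℂ) ^ s‖ ≤
      ‖scalingDenom r s‖ + ‖(1 : ℂ)‖ + ‖∑ j ∈ Iᶜ, (r j : ℂ) ^ s‖ := by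
    have : ∑ j ∈ I, (r j : ℂ) ^ s = -scalingDenom r s + 1 - ∑ j ∈ Iᶜ, (r j : ℂ) ^ s := by
      rw [e2]
      ring
    rw [this]
    refine (norm_sub_le _ _).trans ?_
    gcongr
    refine (norm_add_le _ _).trans ?_
    rw [norm_neg]
  rw [norm_one] at n3
  linarith

theorem norm_scalingDenom_conj (hr : ∀ j, 0 < r j) (s : ℂ) :
    ‖scalingDenom r (starRingEnd ℂ s)‖ = ‖scalingDenom r s‖ := by
  have : scalingDenom r (starRingEnd ℂ s) = starRingEnd ℂ (scalingDenom r s) := by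
    simp only [scalingDenom, map_sub, map_one, map_sum]
    congr 1
    refine Finset.sum_congr rfl fun j _ => ?_
    rw [Complex.cpow_conj, Complex.conj_ofReal]
    rw [Complex.arg_ofReal_of_nonneg (hr j).le]
    exact Real.pi_ne_zero.symm
  rw [this, RCLike.norm_conj]

/-- Almost periodicity of the denominator yields arbitrarily high horizontal lines on which it is
uniformly bounded away from zero. -/
theorem exists_heights_le_norm_scalingDenom (hr : ∀ j, 0 < r j) (hr1 : ∀ j, r j < 1) {D : ℝ}
    (hD : ∑ j, r j ^ D = 1) :
    ∃ (δ : ℝ) (τ : ℕ → ℝ), 0 < δ ∧ StrictMono τ ∧ Tendsto τ atTop atTop ∧ (∀ n, 1 ≤ τ n) ∧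
      ∀ (n : ℕ) (s : ℂ), |s.im| = τ n → δ ≤ ‖scalingDenom r s‖ := by
  have : Nonempty (Fin J) := by
    by_contra h
    rw [not_nonempty_iff] at h
    simp at hD
  obtain ⟨A, hA1, hA⟩ := exists_one_le_norm_scalingDenom hr hr1
  set c := D + 1 with hc
  have hcsum : ∑ j, r j ^ c < 1 := sum_rpow_lt_one hr hr1 hD (by linarith)
  have hr0 : ∀ j, (r j : ℂ) ≠ 0 := fun j => by exact_mod_cast (hr j).ne'
  -- a limit of vertical translates
  obtain ⟨θ, hθ, φ, hφ, hlim⟩ := (isCompact_univ_pi fun _ : Fin J =>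
    isCompact_closedBall (0 : ℂ) 1).tendsto_subseq
    (x := fun (n : ℕ) (j : Fin J) => (r j : ℂ) ^ ((n : ℂ) * Complex.I)) (by
      intro n j _
      rw [mem_closedBall_zero_iff, Complex.norm_cpow_eq_rpow_re_of_pos (hr j)]
      simp)
  have hθ1 : ∀ j, ‖θ j‖ ≤ 1 := fun j => mem_closedBall_zero_iff.1 (hθ j (Set.mem_univ j))
  set q : ℂ → ℂ := fun s => 1 - ∑ j, θ j * (r j : ℂ) ^ s with hq
  have hqd : Differentiable ℂ q := differentiable_one_sub_sum_mul_cpow hr θ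
  have hqc : q c ≠ 0 := by
    have := le_norm_one_sub_sum_mul_cpow hr hr1 hθ1 (c := c) (s := c) (by simp)
    rw [← norm_pos_iff]
    exact (sub_pos.2 hcsum).trans_le this
  have hfin : {z ∈ Set.Icc (-A) c ×ℂ Set.Icc 0 1 | q z = 0}.Finite :=
    finite_zeros_of_isCompact hqd hqc (isCompact_Icc.reProdIm isCompact_Icc)
  -- Only finitely many heights in [0, 1] carry a zero of the limit function `q`; `t₀` is one of the
  -- others.
  obtain ⟨t₀, ht₀, ht₀'⟩ := ((Set.Icc_infinite (zero_lt_one' ℝ)).sdiff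
    (hfin.image Complex.im)).nonempty
  obtain ⟨δ₀, hδ₀, hδ₀q⟩ : ∃ δ₀ : ℝ, 0 < δ₀ ∧ ∀ σ ∈ Set.Icc (-A) c,
      δ₀ ≤ ‖q (σ + t₀ * Complex.I)‖ := by
    rcases (Set.Icc (-A) c).eq_empty_or_nonempty with he | hne
    · exact ⟨1, one_pos, by simp [he]⟩
    obtain ⟨σ₀, hσ₀, hmin⟩ := isCompact_Icc.exists_isMinOn hne
      (f := fun σ : ℝ => ‖q (σ + t₀ * Complex.I)‖)
      (hqd.continuous.comp (by fun_prop)).norm.continuousOn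
    refine ⟨_, norm_pos_iff.2 fun h0 => ht₀' ?_, fun σ hσ => hmin hσ⟩
    refine ⟨σ₀ + t₀ * Complex.I, ⟨Complex.mem_reProdIm.2 ⟨?_, ?_⟩, h0⟩, by simp⟩
    · simpa using hσ₀
    · simpa using ht₀
  -- The weight r_j^{-A} bounds |r_j^s| for Re s ≥ -A, so the translates converge to `q` uniformly
  -- on the whole segment.
  have hdiff : Tendsto (fun k => ∑ j, r j ^ (-A) *
      ‖(r j : ℂ) ^ ((φ k : ℂ) * Complex.I) - θ j‖) atTop (𝓝 0) := by
    rw [← Finset.sum_const_zero (s := (Finset.univ : Finset (Fin J)))]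
    refine tendsto_finsetSum _ fun j _ => ?_
    have h1 : Tendsto (fun k => (r j : ℂ) ^ ((φ k : ℂ) * Complex.I)) atTop (𝓝 (θ j)) :=
      (tendsto_pi_nhds.1 hlim) j
    have h2 := (h1.sub_const (θ j)).norm.const_mul (r j ^ (-A))
    simpa using h2
  obtain ⟨k₀, hk₀⟩ := eventually_atTop.1 (hdiff.eventually (gt_mem_nhds (half_pos hδ₀)))
  have hmain : ∀ k ≥ k₀, ∀ σ ∈ Set.Icc (-A) c,
      δ₀ / 2 ≤ ‖scalingDenom r (σ + (t₀ + φ k : ℝ) * Complex.I)‖ := by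
    intro k hk σ hσ
    have e : scalingDenom r (σ + (t₀ + φ k : ℝ) * Complex.I) = q (σ + t₀ * Complex.I) -
        ∑ j, (r j : ℂ) ^ (σ + t₀ * Complex.I) *
          ((r j : ℂ) ^ ((φ k : ℂ) * Complex.I) - θ j) := by
      simp only [hq, scalingDenom, sub_sub, ← Finset.sum_add_distrib]
      congr 1
      refine Finset.sum_congr rfl fun j _ => ?_
      have : (σ + (t₀ + φ k : ℝ) * Complex.I : ℂ) =
          (σ + t₀ * Complex.I) + (φ k : ℂ) * Complex.I := by
        push_cast
        ring
      rw [this, Complex.cpow_add _ _ (hr0 j)]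
      ring
    have hb : ‖∑ j, (r j : ℂ) ^ (σ + t₀ * Complex.I) *
        ((r j : ℂ) ^ ((φ k : ℂ) * Complex.I) - θ j)‖ < δ₀ / 2 := by
      refine lt_of_le_of_lt ((norm_sum_le _ _).trans (Finset.sum_le_sum fun j _ => ?_)) (hk₀ k hk)
      rw [norm_mul, Complex.norm_cpow_eq_rpow_re_of_pos (hr j)]
      refine mul_le_mul_of_nonneg_right ?_ (norm_nonneg _)
      refine Real.rpow_le_rpow_of_exponent_ge (hr j) (hr1 j).le ?_
      simpa using hσ.1
    have h1 := hδ₀q σ hσ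
    have h2 := norm_sub_norm_le (q (σ + t₀ * Complex.I))
      (∑ j, (r j : ℂ) ^ (σ + t₀ * Complex.I) * ((r j : ℂ) ^ ((φ k : ℂ) * Complex.I) - θ j))
    rw [e]
    linarith
  set δ := min (min 1 (δ₀ / 2)) (1 - ∑ j, r j ^ c) with hδ
  have hτm : StrictMono fun n => t₀ + (φ (n + (k₀ + 1)) : ℝ) := by
    intro m n hmn
    -- The shift by k₀ + 1 puts every index beyond k₀ and also ensures τ ≥ 1.
    have := hφ (show m + (k₀ + 1) < n + (k₀ + 1) by omega)
    simpa using this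
  refine ⟨δ, fun n => t₀ + φ (n + (k₀ + 1)), ?_, hτm, ?_, ?_, ?_⟩
  · exact lt_min (lt_min one_pos (half_pos hδ₀)) (sub_pos.2 hcsum)
  · refine tendsto_atTop_add_const_left _ _ (tendsto_natCast_atTop_atTop.comp ?_)
    exact hφ.tendsto_atTop.comp (tendsto_add_atTop_nat _)
  · intro n
    have h1 : n + (k₀ + 1) ≤ φ (n + (k₀ + 1)) := hφ.id_le _
    have h2 : (1 : ℝ) ≤ φ (n + (k₀ + 1)) := by
      exact_mod_cast (show 1 ≤ n + (k₀ + 1) by omega).trans h1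
    have := ht₀.1
    linarith
  · intro n s hs
    have hpos : ∀ σ : ℝ,
        δ ≤ ‖scalingDenom r (σ + (t₀ + φ (n + (k₀ + 1)) : ℝ) * Complex.I)‖ := by
      intro σ
      rcases le_total σ (-A) with h1 | h1
      · exact ((min_le_left _ _).trans (min_le_left _ _)).trans (hA _ (by simpa using h1))
      rcases le_total c σ with h2 | h2
      · exact (min_le_right _ _).trans (le_norm_scalingDenom hr hr1 (by simpa using h2))
      · exact ((min_le_left _ _).trans (min_le_right _ _)).trans
          (hmain _ (by omega) σ ⟨h1, h2⟩)
    have hp := hpos s.re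
    rw [show t₀ + (φ (n + (k₀ + 1)) : ℝ) = |s.im| from hs.symm] at hp
    -- Negative heights follow by conjugation, since the ratios are real.
    rcases abs_choice s.im with h | h
    · rwa [h, Complex.re_add_im] at hp
    · rw [← norm_scalingDenom_conj hr]
      convert hp using 3
      rw [h]
      apply Complex.ext <;> simp

theorem mem_complexDimensions_iff (hr : ∀ j, 0 < r j) (hr1 : ∀ j, r j < 1) {D : ℝ}
    (hD : ∑ j, r j ^ D = 1) {ω : ℂ} : ω ∈ complexDimensions r ↔ scalingDenom r ω = 0 := by
  have hd := differentiable_scalingDenom hr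
  have han := hd.analyticAt ω
  have hz : scalingZeta r = (scalingDenom r)⁻¹ := rfl
  -- Order ⊤ must be excluded because -⊤ = ⊤, so negation would not reverse its sign. The
  -- denominator is not identically zero, as it has no zeros with Re s > D.
  have hne : meromorphicOrderAt (scalingDenom r) ω ≠ ⊤ := by
    intro htop
    rw [meromorphicOrderAt_eq_top_iff] at htop
    have hall := (hd.differentiableOn (s := Set.univ)).analyticOnNhd isOpen_univ
      |>.eqOn_zero_of_preconnected_of_frequently_eq_zero isPreconnected_univ (Set.mem_univ ω)
        htop.frequently (Set.mem_univ ((D + 1 : ℝ) : ℂ))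
    have := re_le_of_scalingDenom_eq_zero hr hr1 hD hall
    simp at this
    linarith
  rw [complexDimensions, Set.mem_ofPred_eq, hz, meromorphicOrderAt_inv]
  have hpos : 0 < meromorphicOrderAt (scalingDenom r) ω ↔ scalingDenom r ω = 0 := by
    rw [← tendsto_zero_iff_meromorphicOrderAt_pos (AnalyticAt.meromorphicAt han)]
    have hc : Tendsto (scalingDenom r) (𝓝[≠] ω) (𝓝 (scalingDenom r ω)) :=
      (hd.continuous.tendsto ω).mono_left nhdsWithin_le_nhds
    exact ⟨fun h0 => tendsto_nhds_unique hc h0, fun h0 => h0 ▸ hc⟩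
  rw [← hpos]
  obtain ⟨m, hm⟩ := WithTop.ne_top_iff_exists.1 hne
  rw [← hm]
  norm_cast
  exact neg_lt_zero

end ScalingDenom

/-! ### The geometric zeta function -/

theorem geometricZeta_eq {J : ℕ} (d : ℕ) (r : Fin J → ℝ) (κ : ℕ → ℝ) (h g : ℝ) (lam : ℝ → ℝ)
    (ε : ℝ) (s : ℂ) : geometricZeta d r κ h g lam ε s =
      (scalingDenom r s)⁻¹ * (ε : ℂ) ^ ((d : ℂ) - s) * tubeTransform d κ h g lam s := rfl

/-- The zeros of the denominator have real part between -A and D, so a horizontal strip meets them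
in a compact rectangle. -/
theorem finite_tilingDimensions_strip {d J : ℕ} {r : Fin J → ℝ} (hr : ∀ j, 0 < r j)
    (hr1 : ∀ j, r j < 1) {D : ℝ} (hD : ∑ j, r j ^ D = 1) (t : ℝ) :
    {ω ∈ tilingDimensions d r | |ω.im| ≤ t}.Finite := by
  have : Nonempty (Fin J) := by
    by_contra h
    rw [not_nonempty_iff] at h
    simp at hD
  obtain ⟨A, -, hA⟩ := exists_one_le_norm_scalingDenom hr hr1
  have h0 : scalingDenom r ((D + 1 : ℝ) : ℂ) ≠ 0 := fun h0 => by
    have := re_le_of_scalingDenom_eq_zero hr hr1 hD h0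
    simp at this
    linarith
  have hfin := finite_zeros_of_isCompact (differentiable_scalingDenom hr) h0
    ((isCompact_Icc (a := -A) (b := D)).reProdIm (isCompact_Icc (a := -t) (b := t)))
  refine (hfin.union ((Finset.range d).finite_toSet.image fun i : ℕ => (i : ℂ))).subset ?_
  rintro ω ⟨hω | ⟨i, hi, rfl⟩, him⟩
  · rw [mem_complexDimensions_iff hr hr1 hD] at hω
    refine Or.inl ⟨Complex.mem_reProdIm.2 ⟨⟨?_, ?_⟩, abs_le.1 him⟩, hω⟩
    · by_contra h
      have := hA ω (not_le.1 h).le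
      rw [hω, norm_zero] at this
      linarith
    · exact re_le_of_scalingDenom_eq_zero hr hr1 hD hω
  · exact Or.inr ⟨i, by simpa using hi, rfl⟩

/-- The bound does not involve the lower limit, so the horizontal sides are controlled uniformly as
R → ∞. -/
theorem intervalIntegral_rpow_const_le {b x y : ℝ} (hb : 1 < b) :
    ∫ t in x..y, b ^ t ≤ b ^ y / Real.log b := by
  have hb0 : 0 < b := one_pos.trans hb
  have hlog := Real.log_pos hb
  have : ∫ t in x..y, b ^ t = b ^ y / Real.log b - b ^ x / Real.log b := by
    refine intervalIntegral.integral_eq_sub_of_hasDerivAt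
      (f := fun t : ℝ => b ^ t / Real.log b) (fun t _ => ?_)
      (Continuous.intervalIntegrable
        (continuous_const.rpow continuous_id fun _ => Or.inl hb0.ne') _ _)
    have := (Real.hasStrictDerivAt_const_rpow hb0 t).hasDerivAt.div_const (Real.log b)
    rwa [mul_div_cancel_right₀ _ hlog.ne'] at this
  rw [this]
  have : 0 ≤ b ^ x / Real.log b := by positivity
  linarith

namespace IsTubeFunction

variable {V : ℝ → ℝ} {d : ℕ} {κ : ℕ → ℝ} {h g : ℝ} {lam : ℝ → ℝ} {J : ℕ} {r : Fin J → ℝ}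
  {D c ε : ℝ}

theorem meromorphicAt_tubeTransform (H : IsTubeFunction V d κ h g lam) (z : ℂ) :
    MeromorphicAt (tubeTransform d κ h g lam) z := by
  have hpow : ∀ x : ℝ, 0 < x → ∀ i : ℕ, MeromorphicAt (fun s : ℂ => (x : ℂ) ^ (s - (i : ℕ))) z := by
    intro x hx i
    have : Differentiable ℂ fun s : ℂ => (x : ℂ) ^ (s - (i : ℕ)) :=
      (differentiable_id.sub_const _).const_cpow (Or.inl (by exact_mod_cast hx.ne'))
    exact (this.analyticAt z).meromorphicAt
  have hsub : ∀ i : ℕ, MeromorphicAt (fun s : ℂ => s - (i : ℕ)) z := fun i =>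
    (MeromorphicAt.id z).sub (MeromorphicAt.const _ z)
  have h1 : MeromorphicAt (fun s : ℂ => ∑ i ∈ Finset.range d,
      (h : ℂ) ^ (s - i) / (s - i) * (κ i : ℂ)) z := by
    refine MeromorphicAt.fun_sum fun i _ => ?_
    exact ((hpow h H.h_pos i).div (hsub i)).mul (MeromorphicAt.const _ z)
  have h2 : MeromorphicAt (fun s : ℂ => (g : ℂ) ^ (s - d) / (s - d) * (κ d : ℂ)) z :=
    ((hpow g (H.h_pos.trans H.h_lt_g) d).div (hsub d)).mul (MeromorphicAt.const _ z)
  exact (h1.add h2).add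
    ((differentiable_Lam H.h_pos H.h_lt_g H.piecewise.1).analyticAt z).meromorphicAt

theorem differentiableAt_tubeTransform (H : IsTubeFunction V d κ h g lam) {z : ℂ}
    (hz : ∀ i ≤ d, z ≠ (i : ℕ)) : DifferentiableAt ℂ (tubeTransform d κ h g lam) z := by
  have hpow : ∀ x : ℝ, 0 < x → ∀ i : ℕ,
      DifferentiableAt ℂ (fun s : ℂ => (x : ℂ) ^ (s - (i : ℕ))) z := fun x hx i =>
    (differentiableAt_id.sub_const _).const_cpow (Or.inl (by exact_mod_cast hx.ne'))
  have hsub : ∀ i : ℕ, DifferentiableAt ℂ (fun s : ℂ => s - (i : ℕ)) z := fun i =>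
    differentiableAt_id.sub_const _
  refine DifferentiableAt.add (DifferentiableAt.add ?_ ?_)
    (differentiable_Lam H.h_pos H.h_lt_g H.piecewise.1 z)
  · refine DifferentiableAt.fun_sum fun i hi => ?_
    exact ((hpow h H.h_pos i).div (hsub i)
      (sub_ne_zero.2 (hz i (Finset.mem_range.1 hi).le))).mul_const _
  · exact ((hpow g (H.h_pos.trans H.h_lt_g) d).div (hsub d)
      (sub_ne_zero.2 (hz d le_rfl))).mul_const _

theorem meromorphicAt_geometricZeta (H : IsTubeFunction V d κ h g lam) (hr : ∀ j, 0 < r j)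
    (hε : 0 < ε) (z : ℂ) : MeromorphicAt (geometricZeta d r κ h g lam ε) z := by
  have hpow : Differentiable ℂ fun s : ℂ => (ε : ℂ) ^ ((d : ℂ) - s) :=
    (differentiable_id.const_sub _).const_cpow (Or.inl (by exact_mod_cast hε.ne'))
  exact ((((differentiable_scalingDenom hr).analyticAt z).meromorphicAt.inv).mul
    (hpow.analyticAt z).meromorphicAt).mul (H.meromorphicAt_tubeTransform z)

theorem differentiableAt_geometricZeta (H : IsTubeFunction V d κ h g lam) (hr : ∀ j, 0 < r j)
    (hε : 0 < ε) {z : ℂ} (hz : ∀ i ≤ d, z ≠ (i : ℕ)) (hz0 : scalingDenom r z ≠ 0) :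
    DifferentiableAt ℂ (geometricZeta d r κ h g lam ε) z := by
  have hpow : Differentiable ℂ fun s : ℂ => (ε : ℂ) ^ ((d : ℂ) - s) :=
    (differentiable_id.const_sub _).const_cpow (Or.inl (by exact_mod_cast hε.ne'))
  exact (((differentiable_scalingDenom hr z).inv hz0).mul (hpow z)).mul
    (H.differentiableAt_tubeTransform hz)

/-! ### The tube volume of the tiling as a contour integral -/

theorem integrable_pow_mul_tubeTransform (H : IsTubeFunction V d κ h g lam)
    (hr : ∀ j, 0 < r j) (h1 : (d : ℝ) - 1 < c) (h2 : c < d) (k : ℕ) {x : ℝ} (hx : 0 < x) :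
    Integrable fun t : ℝ => (∑ j, (r j : ℂ) ^ (c + t * Complex.I)) ^ k *
      ((x : ℂ) ^ (d - (c + t * Complex.I)) * tubeTransform d κ h g lam (c + t * Complex.I)) := by
  have hc1 : Continuous fun t : ℝ => ∑ j, (r j : ℂ) ^ (c + t * Complex.I) :=
    continuous_finsetSum _ fun j _ => Continuous.const_cpow (by fun_prop)
      (Or.inl (by exact_mod_cast (hr j).ne'))
  have hc2 : Continuous fun t : ℝ => (x : ℂ) ^ (d - (c + t * Complex.I)) :=
    Continuous.const_cpow (by fun_prop) (Or.inl (by exact_mod_cast hx.ne'))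
  refine Integrable.bdd_mul (c := (∑ j, r j ^ c) ^ k) (Integrable.bdd_mul (c := x ^ (d - c))
    (H.integrable_tubeTransform_line h1 h2) hc2.aestronglyMeasurable ?_)
    (hc1.pow k).aestronglyMeasurable ?_
  · refine Eventually.of_forall fun t => ?_
    rw [Complex.norm_cpow_eq_rpow_re_of_pos hx]
    simp
  · refine Eventually.of_forall fun t => ?_
    rw [norm_pow]
    gcongr
    refine (norm_sum_le _ _).trans (Finset.sum_le_sum fun j _ => ?_)
    rw [Complex.norm_cpow_eq_rpow_re_of_pos (hr j)]
    simp

/-- The contour integral for the tube volumes obtained from `V` by the functional equation of a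
self-similar tiling. -/
theorem iterate_eq_integral (H : IsTubeFunction V d κ h g lam)
    (hr : ∀ j, 0 < r j) (h1 : (d : ℝ) - 1 < c) (h2 : c < d) {W : ℕ → ℝ → ℝ} (hW0 : W 0 = V)
    (hW : ∀ k x, W (k + 1) x = ∑ j, r j ^ d * W k (x / r j)) (k : ℕ) {x : ℝ} (hx : 0 < x) :
    (W k x : ℂ) = (1 / (2 * Real.pi) : ℝ) * ∫ t : ℝ,
      (∑ j, (r j : ℂ) ^ (c + t * Complex.I)) ^ k *
      ((x : ℂ) ^ (d - (c + t * Complex.I)) * tubeTransform d κ h g lam (c + t * Complex.I)) := by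
  induction k generalizing x with
  | zero =>
    simp only [pow_zero, one_mul, hW0]
    exact H.eq_integral_tubeTransform h1 h2 hx
  | succ k ih =>
    rw [hW, Complex.ofReal_sum, Finset.sum_congr rfl fun j _ => by
      rw [Complex.ofReal_mul, ih (div_pos hx (hr j)), Complex.ofReal_pow,
        mul_left_comm _ (((1 / (2 * Real.pi) : ℝ)) : ℂ)], ← Finset.mul_sum]
    congr 1
    simp_rw [← integral_const_mul]
    rw [← integral_finsetSum _ fun j _ =>
      (H.integrable_pow_mul_tubeTransform hr h1 h2 k (div_pos hx (hr j))).const_mul _]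
    refine integral_congr_ae (Eventually.of_forall fun t => ?_)
    simp only [pow_succ, mul_assoc, Finset.mul_sum, Finset.sum_mul]
    refine Finset.sum_congr rfl fun j _ => ?_
    have hrj : (r j : ℂ) ≠ 0 := by exact_mod_cast (hr j).ne'
    -- One term of the recursion multiplies the integrand by r_j^s, since r_j^d (x/r_j)^{d-s} =
    -- r_j^s x^{d-s}.
    have e : (r j : ℂ) ^ d * ((x / r j : ℝ) : ℂ) ^ (d - (c + t * Complex.I)) =
        (r j : ℂ) ^ (c + t * Complex.I) * (x : ℂ) ^ (d - (c + t * Complex.I)) := by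
      have hxx : (x : ℂ) = ((x / r j : ℝ) : ℂ) * (r j : ℂ) := by
        rw [← Complex.ofReal_mul, div_mul_cancel₀ _ (hr j).ne']
      conv_rhs => rw [hxx, Complex.mul_cpow_ofReal_nonneg (div_pos hx (hr j)).le (hr j).le]
      rw [mul_left_comm, ← Complex.cpow_add _ _ hrj, mul_comm, add_sub_cancel,
        Complex.cpow_natCast]
    linear_combination ((∑ j, (r j : ℂ) ^ (c + t * Complex.I)) ^ k *
      tubeTransform d κ h g lam (c + t * Complex.I)) * e

/-- On Re s = c > D the ratio ∑_j r_j^s has modulus at most ρ < 1. The integrands are dominated by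
ρ^k ‖T‖ with T integrable, which justifies summing the geometric series under the integral. -/
theorem hasSum_iterate (H : IsTubeFunction V d κ h g lam)
    (hr : ∀ j, 0 < r j) (hr1 : ∀ j, r j < 1) (hD : ∑ j, r j ^ D = 1) (hDc : D < c)
    (h1 : (d : ℝ) - 1 < c) (h2 : c < d) {W : ℕ → ℝ → ℝ} (hW0 : W 0 = V)
    (hW : ∀ k x, W (k + 1) x = ∑ j, r j ^ d * W k (x / r j)) (hε : 0 < ε) :
    (Integrable fun t : ℝ => geometricZeta d r κ h g lam ε (c + t * Complex.I)) ∧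
    HasSum (fun k => (W k ε : ℂ)) ((1 / (2 * Real.pi) : ℝ) * ∫ t : ℝ,
      geometricZeta d r κ h g lam ε (c + t * Complex.I)) := by
  set ρ := ∑ j, r j ^ c with hρ
  have hρ1 : ρ < 1 := sum_rpow_lt_one hr hr1 hD hDc
  have hρ0 : 0 ≤ ρ := Finset.sum_nonneg fun j _ => Real.rpow_nonneg (hr j).le _
  set T : ℝ → ℂ := fun t => (ε : ℂ) ^ (d - (c + t * Complex.I)) *
    tubeTransform d κ h g lam (c + t * Complex.I) with hT
  have hTint : Integrable T := by
    simpa using H.integrable_pow_mul_tubeTransform hr h1 h2 0 hε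
  have hnorm : ∀ t : ℝ, ‖∑ j, (r j : ℂ) ^ (c + t * Complex.I)‖ ≤ ρ := by
    intro t
    refine (norm_sum_le _ _).trans (Finset.sum_le_sum fun j _ => ?_)
    rw [Complex.norm_cpow_eq_rpow_re_of_pos (hr j)]
    simp
  have hgeom : ∀ t : ℝ, HasSum (fun k : ℕ => (∑ j, (r j : ℂ) ^ (c + t * Complex.I)) ^ k * T t)
      (geometricZeta d r κ h g lam ε (c + t * Complex.I)) := by
    intro t
    rw [geometricZeta_eq, mul_assoc]
    exact (hasSum_geometric_of_norm_lt_one ((hnorm t).trans_lt hρ1)).mul_right (T t)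
  have hterm := fun k => H.integrable_pow_mul_tubeTransform hr h1 h2 k hε
  have hsum := hasSum_integral_of_summable_integral_norm hterm ?_
  · have htsum : ∀ t : ℝ, ∑' k : ℕ, (∑ j, (r j : ℂ) ^ (c + t * Complex.I)) ^ k *
        ((ε : ℂ) ^ (d - (c + t * Complex.I)) * tubeTransform d κ h g lam (c + t * Complex.I)) =
        geometricZeta d r κ h g lam ε (c + t * Complex.I) := fun t => (hgeom t).tsum_eq
    simp only [htsum] at hsum
    refine ⟨?_, ?_⟩
    · have hden : Continuous fun t : ℝ => (scalingDenom r (c + t * Complex.I))⁻¹ := by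
        refine Continuous.inv₀ ((differentiable_scalingDenom hr).continuous.comp (by fun_prop))
          fun t h0 => ?_
        have := re_le_of_scalingDenom_eq_zero hr hr1 hD h0
        simp at this
        linarith
      have := Integrable.bdd_mul (c := (1 - ρ)⁻¹) hTint hden.aestronglyMeasurable
        (Eventually.of_forall fun t => ?_)
      · refine this.congr (Eventually.of_forall fun t => ?_)
        simp only [geometricZeta_eq, hT, mul_assoc]
      · rw [norm_inv]
        exact inv_anti₀ (sub_pos.2 hρ1) (le_norm_scalingDenom hr hr1 (by simp))
    · refine (hsum.mul_left (((1 / (2 * Real.pi) : ℝ)) : ℂ)).congr_fun ?_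
      intro k
      exact H.iterate_eq_integral hr h1 h2 hW0 hW k hε
  · refine Summable.of_nonneg_of_le (fun k => integral_nonneg fun t => norm_nonneg _)
      (fun k => ?_) ((summable_geometric_of_lt_one hρ0 hρ1).mul_right (∫ t, ‖T t‖))
    rw [← integral_const_mul]
    refine integral_mono (hterm k).norm (hTint.norm.const_mul _) fun t => ?_
    simp only [norm_mul, norm_pow, hT]
    gcongr
    exact hnorm t

/-! ### Shifting the contour -/

/-- The decay of the geometric zeta function to the left, away from its poles. -/
theorem exists_norm_geometricZeta_le (H : IsTubeFunction V d κ h g lam) (hε : 0 < ε) {δ : ℝ}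
    (hδ : 0 < δ) : ∃ K : ℝ, 0 ≤ K ∧ ∀ s : ℂ, s.re ≤ d → (∀ i ≤ d, 1 ≤ ‖s - (i : ℕ)‖) →
      δ ≤ ‖scalingDenom r s‖ →
      ‖geometricZeta d r κ h g lam ε s‖ ≤ K * (h / ε) ^ s.re / ‖s - d‖ := by
  obtain ⟨K, hK0, hK⟩ := H.exists_norm_tubeTransform_le
  refine ⟨δ⁻¹ * ε ^ (d : ℝ) * K, by positivity, fun s hs hsi hsδ => ?_⟩
  rw [geometricZeta_eq, norm_mul, norm_mul, norm_inv, Complex.norm_cpow_eq_rpow_re_of_pos hε]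
  have e : ε ^ ((d : ℂ) - s).re = ε ^ (d : ℝ) / ε ^ s.re := by
    rw [← Real.rpow_sub hε]
    simp
  rw [e, Real.div_rpow H.h_pos.le hε.le]
  have h3 : 0 < ε ^ s.re := Real.rpow_pos_of_pos hε _
  calc ‖scalingDenom r s‖⁻¹ * (ε ^ (d : ℝ) / ε ^ s.re) * ‖tubeTransform d κ h g lam s‖
      ≤ δ⁻¹ * (ε ^ (d : ℝ) / ε ^ s.re) * (K * h ^ s.re / ‖s - d‖) := by
        gcongr
        exact hK s hs hsi
    _ = _ := by ring

/-- Residue theorem on [-R, c] × [-τ, τ], with R → ∞ at fixed τ. The constant is independent of τ,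
so heights tending to ∞ may be inserted afterwards. -/
theorem norm_sum_residue_sub_integral_le (H : IsTubeFunction V d κ h g lam)
    (hr : ∀ j, 0 < r j) (hr1 : ∀ j, r j < 1) (hD : ∑ j, r j ^ D = 1) (hDc : D < c)
    (h1 : (d : ℝ) - 1 < c) (h2 : c < d) (hε : 0 < ε) (hεh : ε < h) {δ : ℝ} (hδ : 0 < δ) :
    ∃ K : ℝ, ∀ τ : ℝ, 1 ≤ τ → (∀ s : ℂ, |s.im| = τ → δ ≤ ‖scalingDenom r s‖) →
      ‖(∑ᶠ ω ∈ {ω ∈ tilingDimensions d r | |ω.im| ≤ τ},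
          residue (geometricZeta d r κ h g lam ε) ω) -
        (1 / (2 * Real.pi) : ℝ) *
          ∫ t in (-τ)..τ, geometricZeta d r κ h g lam ε (c + t * Complex.I)‖ ≤ K / τ := by
  have : Nonempty (Fin J) := by
    by_contra h
    rw [not_nonempty_iff] at h
    simp at hD
  obtain ⟨A, hA1, hA⟩ := exists_one_le_norm_scalingDenom hr hr1
  -- The denominator is bounded below by δ on the horizontal sides and by 1 on the left side.
  set δ' := min δ 1 with hδ'
  obtain ⟨K, hK0, hK⟩ := H.exists_norm_geometricZeta_le (r := r) hε
    (lt_min hδ one_pos : 0 < δ')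
  set F := geometricZeta d r κ h g lam ε with hF
  set b := h / ε with hb
  have hb1 : 1 < b := (one_lt_div hε).2 hεh
  have hb0 : 0 < b := one_pos.trans hb1
  have hlog := Real.log_pos hb1
  have hd1 : (1 : ℝ) ≤ d := by exact_mod_cast H.d_pos
  have hc0 : 0 < c := by linarith
  -- Only the two horizontal sides survive, each at most (K/τ) b^c / log b.
  refine ⟨1 / (2 * Real.pi) * (2 * (K * (b ^ c / Real.log b))), fun τ hτ hτδ => ?_⟩
  have hτ0 : 0 < τ := one_pos.trans_le hτ
  have hfin := finite_tilingDimensions_strip (d := d) hr hr1 hD τ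
  set S := hfin.toFinset with hS
  rw [finsum_mem_eq_finite_toFinset_sum _ hfin]
  -- the horizontal sides
  have hhor : ∀ R : ℝ, -R ≤ c → ∀ y : ℝ, |y| = τ →
      ‖∫ x in (-R)..c, F (x + y * Complex.I)‖ ≤ K / τ * (b ^ c / Real.log b) := by
    intro R hR y hy
    have hle : ∀ x : ℝ, x ∈ Set.Ioc (-R) c → ‖F (x + y * Complex.I)‖ ≤ K / τ * b ^ x := by
      intro x hx
      have him : ∀ i : ℕ, τ ≤ ‖(x + y * Complex.I : ℂ) - (i : ℕ)‖ := by
        intro i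
        have := Complex.abs_im_le_norm ((x + y * Complex.I : ℂ) - (i : ℕ))
        simpa [hy] using this
      have h3 := hK (x + y * Complex.I) (by simpa using hx.2.trans h2.le)
        (fun i _ => hτ.trans (him i)) ((min_le_left _ _).trans (hτδ _ (by simpa using hy)))
      refine h3.trans ?_
      have hre : (x + y * Complex.I : ℂ).re = x := by simp
      rw [hre, div_mul_eq_mul_div]
      gcongr
      exact him d
    have hcont : Continuous fun x : ℝ => K / τ * b ^ x :=
      continuous_const.mul (continuous_const.rpow continuous_id fun _ => Or.inl hb0.ne')
    refine (intervalIntegral.norm_integral_le_of_norm_le hR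
      (Eventually.of_forall fun x hx => hle x hx) (hcont.intervalIntegrable _ _)).trans ?_
    rw [intervalIntegral.integral_const_mul]
    exact mul_le_mul_of_nonneg_left (intervalIntegral_rpow_const_le hb1) (by positivity)
  -- the left side
  have hleft : ∀ R : ℝ, A ≤ R →
      ‖∫ y in (-τ)..τ, F ((-R : ℝ) + y * Complex.I)‖ ≤ K * b ^ (-R) * (2 * τ) := by
    intro R hR
    have hle : ∀ y ∈ Set.uIoc (-τ) τ, ‖F ((-R : ℝ) + y * Complex.I)‖ ≤ K * b ^ (-R) := by
      intro y _
      have hre : ((-R : ℝ) + y * Complex.I : ℂ).re = -R := by simp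
      have h4 : ∀ i : ℕ, 1 ≤ ‖((-R : ℝ) + y * Complex.I : ℂ) - (i : ℕ)‖ := by
        intro i
        have h5 := Complex.abs_re_le_norm (((-R : ℝ) + y * Complex.I : ℂ) - (i : ℕ))
        rw [Complex.sub_re, hre, Complex.natCast_re] at h5
        have h6 : (0 : ℝ) ≤ i := Nat.cast_nonneg i
        have h7 := neg_le_abs (-R - (i : ℝ))
        linarith
      have h3 := hK ((-R : ℝ) + y * Complex.I) (by rw [hre]; linarith) (fun i _ => h4 i)
        ((min_le_right _ _).trans (hA _ (by rw [hre]; linarith)))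
      rw [hre] at h3
      exact h3.trans (div_le_self (by positivity) (h4 d))
    refine (intervalIntegral.norm_integral_le_of_norm_le_const hle).trans (le_of_eq ?_)
    rw [sub_neg_eq_add, abs_of_pos (by positivity)]
    ring
  -- the residue theorem
  have hrect : ∀ R : ℝ, A ≤ R → rectIntegral F (-R) c (-τ) τ =
      2 * Real.pi * Complex.I * ∑ ω ∈ S, residue F ω := by
    intro R hR
    refine rectIntegral_eq_sum_residue (by linarith) (by linarith) S ?_
      (fun ω _ => H.meromorphicAt_geometricZeta hr hε ω) ?_
    · intro ω hω
      obtain ⟨hω, him⟩ := hfin.mem_toFinset.1 hω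
      rw [Complex.mem_reProdIm, Set.mem_Ioo, Set.mem_Ioo, ← abs_lt]
      rcases hω with hω | ⟨i, hi, rfl⟩
      · rw [mem_complexDimensions_iff hr hr1 hD] at hω
        refine ⟨⟨?_, (re_le_of_scalingDenom_eq_zero hr hr1 hD hω).trans_lt hDc⟩, ?_⟩
        · by_contra hle
          have := hA ω (by linarith)
          rw [hω, norm_zero] at this
          linarith
        · refine lt_of_le_of_ne him fun heq => ?_
          have := hτδ ω heq
          rw [hω, norm_zero] at this
          linarith
      · have h3 : (i : ℝ) + 1 ≤ d := by exact_mod_cast hi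
        have h4 : (0 : ℝ) ≤ i := Nat.cast_nonneg i
        simp only [Complex.natCast_re, Complex.natCast_im, abs_zero]
        exact ⟨⟨by linarith, by linarith⟩, hτ0⟩
    · intro z hz hzS
      rw [Complex.mem_reProdIm, Set.mem_Icc, Set.mem_Icc, ← abs_le] at hz
      have hz' : z ∉ tilingDimensions d r := fun hmem =>
        hzS (hfin.mem_toFinset.2 ⟨hmem, hz.2⟩)
      refine H.differentiableAt_geometricZeta hr hε (fun i hi hzi => ?_) fun h0 =>
        hz' (Or.inl ((mem_complexDimensions_iff hr hr1 hD).2 h0))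
      -- The pole of the bracket at s = d is not a tiling dimension; it lies outside the rectangle
      -- because c < d.
      rcases hi.lt_or_eq with hi | rfl
      · exact hz' (Or.inr ⟨i, hi, hzi⟩)
      · rw [hzi, Complex.natCast_re] at hz
        linarith [hz.1.2]
  have hkey : ∀ R : ℝ, A ≤ R → ‖(∑ ω ∈ S, residue F ω) - (1 / (2 * Real.pi) : ℝ) *
      ∫ t in (-τ)..τ, F (c + t * Complex.I)‖ ≤ 1 / (2 * Real.pi) *
        (2 * (K / τ * (b ^ c / Real.log b)) + K * b ^ (-R) * (2 * τ)) := by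
    intro R hR
    have e := hrect R hR
    rw [rectIntegral] at e
    have hI1 := hhor R (by linarith) (-τ) (by rw [abs_neg, abs_of_pos hτ0])
    have hI2 := hhor R (by linarith) τ (abs_of_pos hτ0)
    have hI3 := hleft R hR
    set I1 := ∫ x in (-R)..c, F (x + (-τ : ℝ) * Complex.I)
    set I2 := ∫ x in (-R)..c, F (x + τ * Complex.I)
    set I3 := ∫ y in (-τ)..τ, F ((-R : ℝ) + y * Complex.I)
    set I4 := ∫ t in (-τ)..τ, F (c + t * Complex.I)
    have hpi : (2 * Real.pi * Complex.I : ℂ) ≠ 0 := Complex.two_pi_I_ne_zero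
    have e2 : (∑ ω ∈ S, residue F ω) - (1 / (2 * Real.pi) : ℝ) * I4 =
        (2 * Real.pi * Complex.I)⁻¹ * (I1 - I2 - Complex.I * I3) := by
      rw [eq_inv_mul_iff_mul_eq₀ hpi, mul_sub, ← e]
      push_cast
      have hpi' : (Real.pi : ℂ) ≠ 0 := by exact_mod_cast Real.pi_ne_zero
      field_simp
      ring
    rw [e2, norm_mul, norm_inv]
    have hn : ‖(2 * Real.pi * Complex.I : ℂ)‖ = 2 * Real.pi := by
      simp [abs_of_pos Real.pi_pos]
    rw [hn, one_div]
    refine mul_le_mul_of_nonneg_left ?_ (by positivity)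
    refine (norm_sub_le _ _).trans ?_
    rw [norm_mul, Complex.norm_I, one_mul]
    have := norm_sub_le I1 I2
    linarith
  have hlim : Tendsto (fun R : ℝ => 1 / (2 * Real.pi) *
      (2 * (K / τ * (b ^ c / Real.log b)) + K * b ^ (-R) * (2 * τ))) atTop
      (𝓝 (1 / (2 * Real.pi) * (2 * (K / τ * (b ^ c / Real.log b)) + K * 0 * (2 * τ)))) := by
    have h3 : Tendsto (fun R : ℝ => b ^ (-R)) atTop (𝓝 0) :=
      (tendsto_rpow_atBot_of_base_gt_one b hb1).comp tendsto_neg_atTop_atBot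
    exact (((h3.const_mul K).mul_const _).const_add _).const_mul _
  -- The left member does not depend on R, so it is bounded by the limit, in which the left side
  -- contributes 0.
  refine (ge_of_tendsto hlim (eventually_atTop.2 ⟨A, hkey⟩)).trans (le_of_eq ?_)
  ring

end IsTubeFunction

/-! ### The tube formula -/

theorem mainTheorem1 {d J : ℕ} (Φ : Fin J → Euc d → Euc d) (r : Fin J → ℝ)
    (F C G : Set (Euc d)) (hF : IsSelfSimilar Φ r F)
    (hC : C = convexHull ℝ F) (hdim : Module.finrank ℝ (vectorSpan ℝ C) = d)
    (htile : TilesetCondition Φ C) (hnontriv : Nontriviality Φ C)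
    (D : ℝ) (hD : ∑ j, r j ^ D = 1) (hdD : (d : ℝ) - 1 < D) (hDd : D < d)
    -- the tiling has the single generator `G`
    (hG : G = tile Φ C 0) (hGconn : IsConnected G)
    (h g : ℝ) (κ : ℕ → ℝ) (lam : ℝ → ℝ)
    (hg : g = inradius G) (hh : 0 < h) (hhg : h < g)
    (hpoly : ∀ ε, 0 < ε → ε < h →
      innerTubeVolume G ε = ∑ i ∈ Finset.range d, κ i * ε ^ (d - i))
    (hlam : ∀ ε, h ≤ ε → ε ≤ g → innerTubeVolume G ε = lam ε)
    (hlamC1 : PiecewiseC1On lam h g)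
    (hκd : κ d = -(volume : Measure (Euc d)).real G) :
    (∀ t : ℝ, {ω ∈ tilingDimensions d r | |ω.im| ≤ t}.Finite) ∧
    -- the sum of residues is the limit of its truncations at suitable heights `τ n`,
    -- which do not depend on `ε`
    ∃ τ : ℕ → ℝ, StrictMono τ ∧ Tendsto τ atTop atTop ∧
      ∀ ε, 0 < ε → ε < h →
        Summable (fun n => innerTubeVolume (tile Φ C n) ε) ∧
        Tendsto
          (fun n => ∑ᶠ ω ∈ {ω ∈ tilingDimensions d r | |ω.im| ≤ τ n},
            residue (geometricZeta d r κ h g lam ε) ω)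
          atTop (𝓝 (tilingTubeVolume Φ C ε : ℂ)) := by
  have hr := hF.ratio_pos
  have hr1 := hF.ratio_lt_one
  -- For d = 0 one would have D < 0, hence J = ∑_j r_j^0 < 1; then there are no maps, and the sum
  -- ∑_j r_j^D is 0.
  have hd : 0 < d := by
    rcases Nat.eq_zero_or_pos d with rfl | hd
    · have h1 := sum_rpow_lt_one hr hr1 hD (c := 0) (by simpa using hDd)
      have h2 : (Finset.univ : Finset (Fin J)).card < 1 := by
        simp only [Real.rpow_zero, Finset.sum_const, nsmul_eq_mul, mul_one] at h1
        exact_mod_cast h1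
      rw [Nat.lt_one_iff, Finset.card_eq_zero] at h2
      rw [h2] at hD
      simp at hD
    · exact hd
  have hCb : Bornology.IsBounded C := hC ▸ isBounded_convexHull.2 hF.isCompact.isBounded
  have hGo : IsOpen G := hG ▸ isOpen_tile hr hF.similitude C 0
  have hGb : Bornology.IsBounded G :=
    hCb.subset (hG ▸ (tile_subset_interior htile 0).trans interior_subset)
  have hGne : G ≠ Set.univ := by
    rintro hGu
    have : Nonempty (Fin d) := ⟨⟨0, hd⟩⟩
    exact NormedSpace.unbounded_univ ℝ (Euc d) (hGu ▸ hGb)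
  have H : IsTubeFunction (innerTubeVolume G) d κ h g lam :=
    { d_pos := hd
      h_pos := hh
      h_lt_g := hhg
      continuousAt := fun x hx =>
        continuousAt_innerTubeVolume hGo hGb.measure_lt_top.ne hGne hx
      poly := hpoly
      eq_lam := hlam
      piecewise := hlamC1
      eq_const := fun x hx => by
        rw [hκd, neg_neg]
        exact innerTubeVolume_eq_volume_of_inradius_le hd hGo hGb (hg ▸ hx) }
  refine ⟨finite_tilingDimensions_strip hr hr1 hD, ?_⟩
  obtain ⟨δ, τ, hδ, hτm, hτlim, hτ1, hτδ⟩ := exists_heights_le_norm_scalingDenom hr hr1 hD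
  refine ⟨τ, hτm, hτlim, fun ε hε hεh => ?_⟩
  -- c > D makes the geometric series converge, and d-1 < D < c < d places the line in the Mellin
  -- strip.
  obtain ⟨c, hDc, hcd⟩ := exists_between hDd
  obtain ⟨hint, hsum⟩ := H.hasSum_iterate hr hr1 hD hDc (hdD.trans hDc) hcd
    (W := fun k => innerTubeVolume (tile Φ C k)) (by rw [hG])
    (innerTubeVolume_tile_succ hr hF.similitude htile hCb hd) hε
  have hsummable : Summable fun n => innerTubeVolume (tile Φ C n) ε :=
    Complex.summable_ofReal.1 hsum.summable
  refine ⟨hsummable, ?_⟩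
  rw [tilingTubeVolume, Complex.ofReal_tsum, hsum.tsum_eq]
  obtain ⟨K, hK⟩ := H.norm_sum_residue_sub_integral_le hr hr1 hD hDc (hdD.trans hDc) hcd hε hεh hδ
  -- The residue sums differ from the integrals over [-τ n, τ n] by at most K/τ n, and these
  -- integrals converge because ζ_𝒯 is integrable on the line.
  have hsmall := squeeze_zero_norm (fun n => hK (τ n) (hτ1 n) (hτδ n))
    (hτlim.const_div_atTop K)
  have hmain := (intervalIntegral_tendsto_integral hint (tendsto_neg_atTop_atBot.comp hτlim)
    hτlim).const_mul (((1 / (2 * Real.pi) : ℝ)) : ℂ)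
  have := hsmall.add hmain
  simpa using this
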